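/- Let $n\ge 1$ and $k>1$ be integers, and write $\mathbb{R}_+^n=\{x\in\mathbb{R}^n : x_i>0 \text{ for all } i\}$. A function $g$ on $\mathbb{R}^n$ is called unconditional if $g(x_1,\dots,x_n)=g(|x_1|,\dots,|x_n|)$ for all $x\in\mathbb{R}^n$. Let $\mu$ be a probability measure on $\mathbb{R}^n$ with density $\exp(-\varphi)$ with respect to Lebesgue measure, where $\varphi:\mathbb{R}^n\to(-\infty,\infty]$ satisfies: - $\varphi$ is unconditional; - $\varphi|_{\mathbb{R}_+^n}$ is increasing, that is, $\varphi(x)\le\varphi(y)$ whenever $x,y\in\mathbb{R}_+^n$ and $x_i\le y_i$ for all $i$; - $\varphi|_{\mathbb{R}_+^n}$ is $(1/k)$-convex, that is, the function $(x_1,\dots,x_n)\mapsto\varphi(x_1^k,\dots,x_n^k)$ is convex on $\mathbb{R}_+^n$. Denote $V_i=\int_{\mathbb{R}^n}x_i^2\,d\mu(x)$ for $i=1,\dots,n$. Let $f:\mathbb{R}^n\to\mathbb{R}$ be a $\mu$-integrable, locally Lipschitz function with $\int_{\mathbb{R}^n} f\,d\mu=0$. Then $$\int_{\mathbb{R}^n}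 f^2\,d\mu\le\int_{\mathbb{R}^n}\sum_{i=1}^n\left(\frac{k^2}{k-1}x_i^2+V_i\right)\left|\partial_i f(x)\right|^2d\mu(x),$$ where $\partial_i f=\partial f/\partial x_i$, which exists almost everywhere. If moreover $f$ is unconditional, then $$\int_{\mathbb{R}^n} f^2\,d\mu\le\frac{k^2}{k-1}\int_{\mathbb{R}^n}\sum_{i=1}^n x_i^2\left|\partial_i f(x)\right|^2d\mu(x).$$ (All these integrals of nonnegative functions are taken in $[0,\infty]$.) -/

import Mathlib

open MeasureTheory
open scoped ENNReal

/-- The orthant `ℝ₊ⁿ` of all points with (strictly) positive coordinates. -/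
def posOrthant (n : ℕ) : Set (Fin n → ℝ) := {x | ∀ i, 0 < x i}

/-- A function on `ℝⁿ` is unconditional if `g (x₁, …, xₙ) = g (|x₁|, …, |xₙ|)` for all `x`. -/
def Unconditional {n : ℕ} {β : Type*} (g : (Fin n → ℝ) → β) : Prop :=
  ∀ x, g x = g (fun i => |x i|)

/-- Convexity, on a set `s`, of a function with values in `(-∞, ∞]`.  (The value `-∞` is to be
excluded separately, so that no expression `∞ - ∞` occurs on the right; `0 * ∞ = 0`.) -/
def ExtConvexOn {n : ℕ} (s : Set (Fin n → ℝ)) (g : (Fin n → ℝ) → EReal) : Prop :=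
  Convex ℝ s ∧ ∀ x ∈ s, ∀ y ∈ s, ∀ a b : ℝ, 0 ≤ a → 0 ≤ b → a + b = 1 →
    g (a • x + b • y) ≤ (a : EReal) * g x + (b : EReal) * g y

/-- The restriction of `φ` to the orthant is `p`-convex: the function
`(x₁, …, xₙ) ↦ φ (x₁ ^ (1/p), …, xₙ ^ (1/p))` is convex on the orthant. -/
def FracConvexOnOrthant {n : ℕ} (p : ℝ) (φ : (Fin n → ℝ) → EReal) : Prop :=
  ExtConvexOn (posOrthant n) (fun x => φ (fun i => x i ^ (1 / p)))

/-- The partial derivative `∂ᵢ f (x)`, i.e. the derivative of `t ↦ f (x + t eᵢ)` at `t = 0`. -/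
noncomputable def partialDeriv {n : ℕ} (i : Fin n) (f : (Fin n → ℝ) → ℝ) (x : Fin n → ℝ) : ℝ :=
  lineDeriv ℝ f x (Pi.single i 1)

/-- `Vᵢ = ∫ xᵢ² dμ`, as an integral of a nonnegative function, with values in `[0, ∞]`. -/
noncomputable def secondMoment {n : ℕ} (μ : Measure (Fin n → ℝ)) (i : Fin n) : ℝ≥0∞ :=
  ∫⁻ x, ENNReal.ofReal (x i ^ 2) ∂μ

/-! Write `k = j + 1`. In the coordinates `y` with `x = y ^ k` on the orthant, the density `w = exp
(-φ)` is log-concave, and the Jacobian contributes the further log-concave factor `∏ y_i ^ j`. The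
convexity of `-j log` is what produces a spectral gap weighted by `x_i²`: for the points `z (1 ± η)
^ k`, whose `y`-midpoint corresponds to `z`, the Jacobians gain the factor `∏ (1 - η_i²) ^ j`.

On the orthant this becomes a Poincaré inequality by linearising Prékopa–Leindler
(`prekopa_leindler_posOrthant`). It is applied to `w exp (2 ε f)`, `w` and `w` times the
sup-convolution `expSupConv`. Since `log (1 - t²) ≤ -t²`, the exponent of the sup-convolution is at
most `ε f + ε² Σ (k z_i ∂_i f)² / (2 j) + o(ε²)`, by maximising `A t - j t² / 2`. Comparing the
terms of order `ε²` (`variance_le_of_forall_exp_le`) bounds the variance on the orthant with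
constant `k² / j`; truncation to boxes makes the expansion uniform (`variance_le_of_support_subset`,
`variance_le_posOrthant`).

On the whole space, `μ` is invariant under sign changes, so the orthant inequality applies to `f`
composed with each reflection. What remains is the variance of the integrals `a σ` of `f` over the
orthants. They are all zero if `f` is unconditional and has mean zero. In general the Poincaré
inequality on the discrete cube (`sum_sq_le_cube`) reduces their variance to differences between
neighbouring orthants. Neighbouring reflections of `f` agree on the common wall, so such a
difference is an integral of `∂_i f` from the wall, and a Hardy-type inequality for decreasing
densities (`hardy_Ioi`, `enorm_integral_sub_sq_le`) bounds it with the second moment. This is where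
monotonicity of `φ` enters, and where the terms `V_i` come from. -/

/-! ### Brunn–Minkowski and Prékopa–Leindler on the line -/

/-- The one-dimensional Brunn–Minkowski inequality for compact sets. -/
theorem volume_add_le_of_isCompact {K L C : Set ℝ} (hK : IsCompact K) (hL : IsCompact L)
    (hK0 : K.Nonempty) (hL0 : L.Nonempty) (h : ∀ x ∈ K, ∀ y ∈ L, (x + y) / 2 ∈ C) :
    volume K + volume L ≤ 2 * volume C := by
  obtain ⟨M, hM⟩ := hK.exists_isGreatest hK0
  obtain ⟨m, hm⟩ := hL.exists_isLeast hL0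
  set D : Set ℝ := (fun x => (2⁻¹ : ℝ) * x) ⁻¹' C with hD
  have hDvol : volume D = 2 * volume C := by
    rw [hD, Real.volume_preimage_mul_left (by norm_num)]
    simp
  -- `D` is the dilate `2 C`. It contains the translates `K + m` and `M + L`, which lie on either
  -- side of `M + m` and share only that point.
  rw [← hDvol, ← measure_inter_add_sdiff D (measurableSet_Iic (a := M + m))]
  refine add_le_add ?_ ?_
  · have : volume ((fun x => -m + x) ⁻¹' K) = volume K := measure_preimage_add _ _ _
    rw [← this]
    refine measure_mono fun x hx => ⟨?_, ?_⟩
    · have := h _ hx m hm.1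
      simp only [hD, Set.mem_preimage]
      convert this using 1
      ring
    · have := hM.2 hx
      simp only [Set.mem_Iic]
      linarith
  · have : volume ((fun x => -M + x) ⁻¹' L) = volume L := measure_preimage_add _ _ _
    rw [← this]
    calc volume ((fun x => -M + x) ⁻¹' L) ≤ volume ((D \ Set.Iic (M + m)) ∪ {M + m}) := by
          refine measure_mono fun x hx => ?_
          have h1 := h M hM.1 _ hx
          have h2 := hm.2 hx
          by_cases hx' : x = M + m
          · right; exact hx'
          · left
            refine ⟨?_, ?_⟩
            · simp only [hD, Set.mem_preimage]
              convert h1 using 1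
              ring
            · simp only [Set.mem_Iic, not_le]
              exact lt_of_le_of_ne (by linarith) (Ne.symm hx')
      _ ≤ _ := (measure_union_le _ _).trans (by simp)

/-- The one-dimensional Brunn–Minkowski inequality. -/
theorem volume_add_le {A B C : Set ℝ} (hA : MeasurableSet A) (hB : MeasurableSet B)
    (hA0 : A.Nonempty) (hB0 : B.Nonempty) (h : ∀ x ∈ A, ∀ y ∈ B, (x + y) / 2 ∈ C) :
    volume A + volume B ≤ 2 * volume C := by
  obtain ⟨a, ha⟩ := hA0
  obtain ⟨b, hb⟩ := hB0
  rw [hA.measure_eq_iSup_isCompact, hB.measure_eq_iSup_isCompact]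
  simp only [iSup_and']
  refine ENNReal.biSup_add_biSup_le' ⟨∅, by simp⟩ ⟨∅, by simp⟩ ?_
  rintro K ⟨hKA, hK⟩ L ⟨hLB, hL⟩
  -- Adjoining `a` and `b` keeps the compact approximants nonempty.
  refine le_trans (add_le_add (measure_mono (Set.subset_union_left (t := {a})))
    (measure_mono (Set.subset_union_left (t := {b}))))
    (volume_add_le_of_isCompact (hK.union isCompact_singleton) (hL.union isCompact_singleton)
    ⟨a, by simp⟩ ⟨b, by simp⟩ fun x hx y hy => h _ ?_ _ ?_)
  · rcases hx with hx | rfl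
    exacts [hKA hx, ha]
  · rcases hy with hy | rfl
    exacts [hLB hy, hb]

/-- The Prékopa–Leindler inequality on the line, in additive form, for functions of supremum `1`. -/
theorem lintegral_add_le_of_mul_le_sq {u v m : ℝ → ℝ} (hu : Measurable u) (hv : Measurable v)
    (hm : Measurable m) (hu0 : 0 ≤ u) (hv0 : 0 ≤ v) (hm0 : 0 ≤ m) (hu1 : ∀ x, u x ≤ 1)
    (hv1 : ∀ x, v x ≤ 1) (hus : ∀ t < 1, ∃ x, t < u x) (hvs : ∀ t < 1, ∃ x, t < v x)
    (h : ∀ x y, u x * v y ≤ m ((x + y) / 2) ^ 2) :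
    (∫⁻ x, ENNReal.ofReal (u x)) + ∫⁻ x, ENNReal.ofReal (v x) ≤
      2 * ∫⁻ x, ENNReal.ofReal (m x) := by
  rw [lintegral_eq_lintegral_meas_lt _ (ae_of_all _ hu0) hu.aemeasurable,
    lintegral_eq_lintegral_meas_lt _ (ae_of_all _ hv0) hv.aemeasurable,
    lintegral_eq_lintegral_meas_lt _ (ae_of_all _ hm0) hm.aemeasurable]
  have hanti : ∀ f : ℝ → ℝ, Measurable fun t => volume {a : ℝ | t < f a} := fun f =>
    Antitone.measurable fun s t hst => measure_mono fun a (ha : t < f a) => hst.trans_lt ha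
  rw [← lintegral_add_left (hanti u), ← lintegral_const_mul _ (hanti m)]
  refine setLIntegral_mono ((hanti m).const_mul _) fun t ht => ?_
  -- Brunn–Minkowski needs nonempty superlevel sets. As both suprema are `1`, the two sets are
  -- nonempty for `t < 1` and empty for `t ≥ 1`.
  rcases lt_or_ge t 1 with ht1 | ht1
  · refine volume_add_le (measurableSet_lt measurable_const hu)
      (measurableSet_lt measurable_const hv) (hus t ht1) (hvs t ht1) fun x hx y hy => ?_
    have h1 := h x y
    simp only [Set.mem_ofPred_eq, Set.mem_Ioi] at hx hy ht ⊢
    have h2 : t * t < u x * v y := mul_lt_mul'' hx hy ht.le ht.le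
    exact lt_of_pow_lt_pow_left₀ 2 (hm0 _) (by nlinarith)
  · have h1 : {a | t < u a} = ∅ := Set.eq_empty_of_forall_notMem fun a ha =>
      absurd (hu1 a) (not_le.2 (ht1.trans_lt ha))
    have h2 : {a | t < v a} = ∅ := Set.eq_empty_of_forall_notMem fun a ha =>
      absurd (hv1 a) (not_le.2 (ht1.trans_lt ha))
    simp [h1, h2]

theorem ENNReal.mul_le_sq_of_add_le {a b c : ℝ≥0∞} (h : a + b ≤ 2 * c) : a * b ≤ c ^ 2 := by
  rcases eq_or_ne c ∞ with rfl | hc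
  · simp
  have hab : a + b ≠ ∞ := ne_top_of_le_ne_top (ENNReal.mul_ne_top (by simp) hc) h
  lift a to NNReal using (ENNReal.add_ne_top.1 hab).1
  lift b to NNReal using (ENNReal.add_ne_top.1 hab).2
  lift c to NNReal using hc
  norm_cast at h ⊢
  have h' : (a : ℝ) + b ≤ 2 * c := by exact_mod_cast h
  have : (a : ℝ) * b ≤ c ^ 2 := by 
    have h1 := mul_self_le_mul_self (add_nonneg a.coe_nonneg b.coe_nonneg) h'
    nlinarith [sq_nonneg ((a : ℝ) - b)]
  exact_mod_cast this

/-- Homogeneity: dividing `u`, `v` by their suprema `a`, `b` and `m` by `s = √(a b)` reduces to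
suprema equal to `1`, where the stronger additive form holds; the arithmetic–geometric mean
inequality then returns to products. Cutting `m / s` at `1` keeps it finite and costs nothing, since
the normalised product is at most `1`. -/
theorem prekopa_leindler_of_bounded {u v m : ℝ → ℝ≥0∞} (hu : Measurable u) (hv : Measurable v)
    (hm : Measurable m) {N : ℝ≥0∞} (hN : N ≠ ∞) (huN : ∀ x, u x ≤ N) (hvN : ∀ x, v x ≤ N)
    (h : ∀ x y, u x * v y ≤ m ((x + y) / 2) ^ 2) :
    (∫⁻ x, u x) * ∫⁻ x, v x ≤ (∫⁻ x, m x) ^ 2 := by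
  set a := ⨆ x, u x with ha
  set b := ⨆ x, v x with hb
  have hua : ∀ x, u x ≤ a := fun x => le_iSup u x
  have hvb : ∀ x, v x ≤ b := fun x => le_iSup v x
  have haN : a ≠ ∞ := ne_top_of_le_ne_top hN (iSup_le huN)
  have hbN : b ≠ ∞ := ne_top_of_le_ne_top hN (iSup_le hvN)
  rcases eq_or_ne a 0 with ha0 | ha0
  · have : ∀ x, u x = 0 := fun x => le_antisymm (ha0 ▸ hua x) bot_le
    simp [this]
  rcases eq_or_ne b 0 with hb0 | hb0
  · have : ∀ x, v x = 0 := fun x => le_antisymm (hb0 ▸ hvb x) bot_le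
    simp [this]
  obtain ⟨s, hs⟩ : ∃ s : ℝ≥0∞, s ^ 2 = a * b :=
    ⟨(a * b) ^ (1 / 2 : ℝ), by rw [← ENNReal.rpow_natCast, ← ENNReal.rpow_mul]; norm_num⟩
  have hab0 : a * b ≠ 0 := mul_ne_zero ha0 hb0
  have habN : a * b ≠ ∞ := ENNReal.mul_ne_top haN hbN
  have hs0 : s ≠ 0 := by rintro rfl; simp at hs; tauto
  have hsN : s ≠ ∞ := by rintro rfl; simp at hs; tauto
  have hu1 : ∀ x, u x / a ≤ 1 := fun x => ENNReal.div_le_of_le_mul (by simpa using hua x)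
  have hv1 : ∀ x, v x / b ≤ 1 := fun x => ENNReal.div_le_of_le_mul (by simpa using hvb x)
  have hrel : ∀ x y, (u x / a) * (v y / b) ≤ (min (m ((x + y) / 2) / s) 1) ^ 2 := by
    intro x y
    rcases le_total (m ((x + y) / 2) / s) 1 with h1 | h1
    · rw [min_eq_left h1, ENNReal.div_eq_inv_mul, ENNReal.div_eq_inv_mul, ENNReal.div_eq_inv_mul,
        mul_pow, ← ENNReal.inv_pow, hs, ENNReal.mul_inv (Or.inl ha0) (Or.inl haN)]
      calc _ = a⁻¹ * b⁻¹ * (u x * v y) := by ring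
        _ ≤ _ := by gcongr; exact h x y
    · rw [min_eq_right h1]
      simpa using mul_le_mul' (hu1 x) (hv1 y)
  have hsup : ∀ (f : ℝ → ℝ≥0∞) (c : ℝ≥0∞), c = ⨆ x, f x → c ≠ 0 → c ≠ ∞ → (∀ x, f x / c ≤ 1) →
      ∀ t < (1 : ℝ), ∃ x, t < (f x / c).toReal := by
    intro f c hc hc0 hcN hf1 t ht
    have h1 : ENNReal.ofReal t * c < ⨆ x, f x := by
      rw [← hc]
      calc ENNReal.ofReal t * c < 1 * c := by
            refine ENNReal.mul_lt_mul_left hc0 hcN ?_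
            simpa using ht
        _ = c := one_mul c
    obtain ⟨x, hx⟩ := lt_iSup_iff.1 h1
    refine ⟨x, ?_⟩
    have h2 : ENNReal.ofReal t < f x / c :=
      (ENNReal.lt_div_iff_mul_lt (Or.inl hc0) (Or.inl hcN)).2 hx
    rcases lt_or_ge t 0 with ht0 | ht0
    · exact ht0.trans_le ENNReal.toReal_nonneg
    · exact (ENNReal.ofReal_lt_iff_lt_toReal ht0
        (ne_top_of_le_ne_top ENNReal.one_ne_top (hf1 x))).1 h2
  have hmin : ∀ x, min (m x / s) 1 ≤ 1 := fun x => min_le_right _ _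
  have key := lintegral_add_le_of_mul_le_sq (u := fun x => (u x / a).toReal)
    (v := fun x => (v x / b).toReal) (m := fun x => (min (m x / s) 1).toReal)
    (hu.div_const a).ennreal_toReal (hv.div_const b).ennreal_toReal
    ((hm.div_const s).min measurable_const).ennreal_toReal
    (fun x => ENNReal.toReal_nonneg) (fun x => ENNReal.toReal_nonneg)
    (fun x => ENNReal.toReal_nonneg)
    (fun x => by simpa using ENNReal.toReal_mono ENNReal.one_ne_top (hu1 x))
    (fun x => by simpa using ENNReal.toReal_mono ENNReal.one_ne_top (hv1 x))
    (hsup u a ha ha0 haN hu1) (hsup v b hb hb0 hbN hv1)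
    (fun x y => by
      have := ENNReal.toReal_mono
        (ENNReal.pow_ne_top (ne_top_of_le_ne_top ENNReal.one_ne_top (hmin _))) (hrel x y)
      simpa [ENNReal.toReal_mul, ENNReal.toReal_pow] using this)
  simp only [ENNReal.ofReal_toReal (ne_top_of_le_ne_top ENNReal.one_ne_top (hu1 _)),
    ENNReal.ofReal_toReal (ne_top_of_le_ne_top ENNReal.one_ne_top (hv1 _)),
    ENNReal.ofReal_toReal (ne_top_of_le_ne_top ENNReal.one_ne_top (hmin _))] at key
  have key2 := ENNReal.mul_le_sq_of_add_le (key.trans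
    (mul_le_mul' le_rfl (lintegral_mono fun x => min_le_left (m x / s) 1)))
  simp only [ENNReal.div_eq_inv_mul] at key2
  rw [lintegral_const_mul _ hu, lintegral_const_mul _ hv, lintegral_const_mul _ hm, mul_pow,
    ← ENNReal.inv_pow, hs] at key2
  calc (∫⁻ x, u x) * ∫⁻ x, v x
      = (a * b) * ((a⁻¹ * ∫⁻ x, u x) * (b⁻¹ * ∫⁻ x, v x)) := by
        calc _ = (a * a⁻¹) * (b * b⁻¹) * ((∫⁻ x, u x) * ∫⁻ x, v x) := by
              rw [ENNReal.mul_inv_cancel ha0 haN, ENNReal.mul_inv_cancel hb0 hbN]; simp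
          _ = _ := by ring
    _ ≤ (a * b) * ((a * b)⁻¹ * (∫⁻ x, m x) ^ 2) := by gcongr
    _ = _ := by rw [← mul_assoc, ENNReal.mul_inv_cancel hab0 habN, one_mul]

/-- The Prékopa–Leindler inequality on the line, at the midpoint. -/
theorem prekopa_leindler_real {u v m : ℝ → ℝ≥0∞} (hu : Measurable u) (hv : Measurable v)
    (hm : Measurable m) (h : ∀ x y, u x * v y ≤ m ((x + y) / 2) ^ 2) :
    (∫⁻ x, u x) * ∫⁻ x, v x ≤ (∫⁻ x, m x) ^ 2 := by
  have hlim : ∀ f : ℝ → ℝ≥0∞, Measurable f →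
      ∫⁻ x, f x = ⨆ N : ℕ, ∫⁻ x, min (f x) N := by
    intro f hf
    rw [← lintegral_iSup (fun N => hf.min measurable_const)
      (fun N M hNM x => min_le_min le_rfl (by exact_mod_cast hNM))]
    congr with x
    refine le_antisymm ?_ (iSup_le fun N => min_le_left _ _)
    refine le_of_forall_lt fun c hc => ?_
    obtain ⟨N, hN⟩ := ENNReal.exists_nat_gt hc.ne_top
    exact (lt_min hc hN).trans_le (le_iSup (fun N : ℕ => min (f x) (N : ℝ≥0∞)) N)
  have hmono : ∀ f : ℝ → ℝ≥0∞, Monotone fun N : ℕ => ∫⁻ x, min (f x) (N : ℝ≥0∞) :=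
    fun f N M hNM => lintegral_mono fun x => min_le_min le_rfl (by exact_mod_cast hNM)
  rw [hlim u hu, hlim v hv, ENNReal.iSup_mul]
  refine iSup_le fun N => ?_
  rw [ENNReal.mul_iSup]
  refine iSup_le fun M => ?_
  exact (mul_le_mul' (hmono u (le_max_left N M)) (hmono v (le_max_right N M))).trans <|
    prekopa_leindler_of_bounded (hu.min measurable_const)
    (hv.min measurable_const) hm (ENNReal.natCast_ne_top (max N M)) (fun x => min_le_right _ _)
    (fun x => min_le_right _ _) fun x y =>
      (mul_le_mul' (min_le_left _ _) (min_le_left _ _)).trans (h x y)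

/-! ### Prékopa–Leindler after the power substitution, on the half-line and the orthant -/

/-- The Prékopa–Leindler inequality on the half-line, for the mean that the substitution
`x = y ^ (j + 1)` makes the arithmetic one. -/
theorem prekopa_leindler_Ioi (j : ℕ) {u v m : ℝ → ℝ≥0∞} (hu : Measurable u) (hv : Measurable v)
    (hm : Measurable m)
    (h : ∀ z η : ℝ, 0 < z → |η| < 1 →
      u (z * (1 + η) ^ (j + 1)) * v (z * (1 - η) ^ (j + 1)) * ENNReal.ofReal ((1 - η ^ 2) ^ j) ≤
        m z ^ 2) :
    (∫⁻ x in Set.Ioi 0, u x) * ∫⁻ x in Set.Ioi 0, v x ≤ (∫⁻ x in Set.Ioi 0, m x) ^ 2 := by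
  set J : ℝ → ℝ≥0∞ := fun y => ENNReal.ofReal ((j + 1) * y ^ j) with hJ
  have himage : (fun y : ℝ => y ^ (j + 1)) '' Set.Ioi 0 = Set.Ioi 0 := by
    ext x
    constructor
    · rintro ⟨y, hy, rfl⟩
      exact pow_pos (Set.mem_Ioi.1 hy) _
    · intro hx
      exact ⟨x ^ ((j + 1 : ℕ) : ℝ)⁻¹, Real.rpow_pos_of_pos hx _,
        Real.rpow_inv_natCast_pow hx.le (Nat.succ_ne_zero j)⟩
  have hchange : ∀ g : ℝ → ℝ≥0∞, ∫⁻ x in Set.Ioi 0, g x =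
      ∫⁻ y, (Set.Ioi 0).indicator (fun y => J y * g (y ^ (j + 1))) y := by
    intro g
    rw [lintegral_indicator measurableSet_Ioi]
    conv_lhs => rw [← himage]
    rw [lintegral_image_eq_lintegral_abs_deriv_mul (f' := fun y => (j + 1) * y ^ j)
      measurableSet_Ioi]
    · refine setLIntegral_congr_fun measurableSet_Ioi fun y (hy : 0 < y) => ?_
      simp only [hJ]
      rw [abs_of_nonneg (by positivity)]
    · intro y _
      have := (hasDerivAt_pow (j + 1) y).hasDerivWithinAt (s := Set.Ioi 0)
      simpa using this
    · exact fun x (hx : 0 < x) y (hy : 0 < y) hxy =>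
        (pow_left_inj₀ hx.le hy.le (Nat.succ_ne_zero j)).1 hxy
  have hJm : Measurable J := by fun_prop
  have hmeas : ∀ g : ℝ → ℝ≥0∞, Measurable g →
      Measurable ((Set.Ioi 0).indicator (fun y => J y * g (y ^ (j + 1)))) := fun g hg =>
    (hJm.mul (hg.comp (measurable_id.pow_const _))).indicator measurableSet_Ioi
  rw [hchange u, hchange v, hchange m]
  refine prekopa_leindler_real (hmeas u hu) (hmeas v hv) (hmeas m hm) fun x y => ?_
  by_cases hx : x ∈ Set.Ioi (0 : ℝ)
  swap
  · rw [Set.indicator_of_notMem hx]; simp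
  by_cases hy : y ∈ Set.Ioi (0 : ℝ)
  swap
  · rw [Set.indicator_of_notMem hy]; simp
  have hx' : 0 < x := hx
  have hy' : 0 < y := hy
  have hz : (x + y) / 2 ∈ Set.Ioi (0 : ℝ) := by simp only [Set.mem_Ioi]; positivity
  rw [Set.indicator_of_mem hx, Set.indicator_of_mem hy, Set.indicator_of_mem hz]
  -- Midpoint and relative half-difference, so that `x = z (1 + η)` and `y = z (1 - η)`.
  set z := (x + y) / 2 with hzdef
  set η := (x - y) / (x + y) with hη
  have hxy : x + y ≠ 0 := by positivity
  have e1 : z * (1 + η) = x := by rw [hzdef, hη]; field_simp; ring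
  have e2 : z * (1 - η) = y := by rw [hzdef, hη]; field_simp; ring
  have hη1 : |η| < 1 := by
    rw [hη, abs_div, abs_of_pos (add_pos hx' hy'), div_lt_one (by positivity), abs_lt]
    constructor <;> linarith
  have key := h (z ^ (j + 1)) η (pow_pos hz _) hη1
  rw [← mul_pow, ← mul_pow, e1, e2] at key
  have hJJ : J x * J y = J z ^ 2 * ENNReal.ofReal ((1 - η ^ 2) ^ j) := by
    have hz' : (0 : ℝ) < z := hz
    simp only [hJ]
    rw [← ENNReal.ofReal_mul (by positivity), ← ENNReal.ofReal_pow (by positivity),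
      ← ENNReal.ofReal_mul (by positivity)]
    congr 1
    have : x * y = z ^ 2 * (1 - η ^ 2) := by rw [← e1, ← e2]; ring
    calc _ = ((j : ℝ) + 1) ^ 2 * (x * y) ^ j := by rw [mul_pow x y]; ring
      _ = _ := by rw [this, mul_pow, ← pow_mul, mul_pow, ← pow_mul, mul_comm 2 j]; ring
  calc J x * u (x ^ (j + 1)) * (J y * v (y ^ (j + 1)))
      = (J x * J y) * (u (x ^ (j + 1)) * v (y ^ (j + 1))) := by ring
    _ = J z ^ 2 * (u (x ^ (j + 1)) * v (y ^ (j + 1)) * ENNReal.ofReal ((1 - η ^ 2) ^ j)) := by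
        rw [hJJ]; ring
    _ ≤ J z ^ 2 * m (z ^ (j + 1)) ^ 2 := by gcongr
    _ = _ := by ring

/-- Integration over one coordinate and then over the others. -/
theorem lintegral_pi_eq_lintegral_insertNth {n : ℕ} (ν : Measure ℝ) [SigmaFinite ν]
    (i : Fin (n + 1)) {F : (Fin (n + 1) → ℝ) → ℝ≥0∞}
    (hF : AEMeasurable F (Measure.pi fun _ => ν)) :
    ∫⁻ x, F x ∂(Measure.pi fun _ => ν) =
      ∫⁻ t, ∫⁻ y, F (i.insertNth t y) ∂(Measure.pi fun _ => ν) ∂ν := by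
  have hp := (measurePreserving_piFinSuccAbove (fun _ : Fin (n + 1) => ν) i).symm
  rw [← hp.lintegral_comp_emb (MeasurableEquiv.measurableEmbedding _), lintegral_prod]
  · rfl
  · exact hF.comp_quasiMeasurePreserving hp.quasiMeasurePreserving

theorem prekopa_leindler_pi (j : ℕ) : ∀ (n : ℕ) {u v m : (Fin n → ℝ) → ℝ≥0∞}, Measurable u →
    Measurable v → Measurable m →
    (∀ z η : Fin n → ℝ, (∀ i, 0 < z i) → (∀ i, |η i| < 1) →
      u (fun i => z i * (1 + η i) ^ (j + 1)) * v (fun i => z i * (1 - η i) ^ (j + 1)) *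
        ∏ i, ENNReal.ofReal ((1 - η i ^ 2) ^ j) ≤ m z ^ 2) →
    (∫⁻ x, u x ∂(Measure.pi fun _ => volume.restrict (Set.Ioi 0))) *
      ∫⁻ x, v x ∂(Measure.pi fun _ => volume.restrict (Set.Ioi 0)) ≤
        (∫⁻ x, m x ∂(Measure.pi fun _ => volume.restrict (Set.Ioi 0))) ^ 2
  | 0, u, v, m, hu, hv, hm, h => by
    have hc : ∀ f : (Fin 0 → ℝ) → ℝ≥0∞,
        ∫⁻ x, f x ∂(Measure.pi fun _ => volume.restrict (Set.Ioi 0)) = f default := fun f => by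
      rw [Measure.pi_of_empty _ default, lintegral_dirac]
    rw [hc, hc, hc]
    have := h default default (fun i => i.elim0) (fun i => i.elim0)
    have h0 : ∀ y : Fin 0 → ℝ, y = default := fun y => Subsingleton.elim _ _
    rw [h0 fun i => _, h0 fun i => (default : Fin 0 → ℝ) i * (1 - (default : Fin 0 → ℝ) i) ^ (j + 1),
      Fin.prod_univ_zero, mul_one] at this
    exact this
  | n + 1, u, v, m, hu, hv, hm, h => by
    have hins : Measurable fun p : ℝ × (Fin n → ℝ) =>
        ((0 : Fin (n + 1)).insertNth p.1 p.2 : Fin (n + 1) → ℝ) :=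
      (MeasurableEquiv.piFinSuccAbove (fun _ : Fin (n + 1) => ℝ) 0).symm.measurable
    have hsec : ∀ t : ℝ, Measurable fun y : Fin n → ℝ =>
        ((0 : Fin (n + 1)).insertNth t y : Fin (n + 1) → ℝ) := fun t =>
      hins.comp measurable_prodMk_left
    have hmeas : ∀ f : (Fin (n + 1) → ℝ) → ℝ≥0∞, Measurable f → Measurable fun t =>
        ∫⁻ y, f ((0 : Fin (n + 1)).insertNth t y)
          ∂(Measure.pi fun _ => volume.restrict (Set.Ioi 0)) := fun f hf =>
      (hf.comp hins).lintegral_prod_right'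
    rw [lintegral_pi_eq_lintegral_insertNth _ 0 hu.aemeasurable,
      lintegral_pi_eq_lintegral_insertNth _ 0 hv.aemeasurable,
      lintegral_pi_eq_lintegral_insertNth _ 0 hm.aemeasurable]
    refine prekopa_leindler_Ioi j (hmeas u hu) (hmeas v hv) (hmeas m hm) fun z η hz hη => ?_
    set c := ENNReal.ofReal ((1 - η ^ 2) ^ j)
    have hvs : Measurable fun y => v ((0 : Fin (n + 1)).insertNth (z * (1 - η) ^ (j + 1)) y) :=
      hv.comp (hsec _)
    rw [mul_assoc, ← lintegral_mul_const _ hvs]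
    -- Once the first coordinates are fixed, their factor `c` is a constant; absorbed into `v`, it
    -- lets the induction hypothesis apply to the slices.
    refine prekopa_leindler_pi j n (hu.comp (hsec _)) (hvs.mul_const c) (hm.comp (hsec z))
      fun z' η' hz' hη' => ?_
    have key := h (Fin.cons z z') (Fin.cons η η') (Fin.cases hz hz') (Fin.cases hη hη')
    rw [Fin.prod_univ_succ] at key
    simp only [Fin.cons_zero, Fin.cons_succ] at key
    have hcons : ∀ (s : ℝ) (w w' : ℝ) (y y' : Fin n → ℝ),
        (fun i => (Fin.cons w y : Fin (n + 1) → ℝ) i *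
          (1 + s * (Fin.cons w' y' : Fin (n + 1) → ℝ) i) ^ (j + 1)) =
        ((0 : Fin (n + 1)).insertNth (w * (1 + s * w') ^ (j + 1))
          (fun i => y i * (1 + s * y' i) ^ (j + 1)) : Fin (n + 1) → ℝ) := by
      intro s w w' y y'
      rw [Fin.insertNth_zero]
      funext i
      refine Fin.cases ?_ (fun i => ?_) i <;> simp
    have h1 := hcons 1 z η z' η'
    have h2 := hcons (-1) z η z' η'
    simp only [one_mul, neg_one_mul, ← sub_eq_add_neg] at h1 h2
    rw [h1, h2] at key
    rw [show (Fin.insertNth 0 z z' : Fin (n + 1) → ℝ) = Fin.cons z z' by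
      rw [Fin.insertNth_zero]; rfl]
    calc _ = _ := by ring
      _ ≤ _ := key

theorem restrict_posOrthant (n : ℕ) : (volume : Measure (Fin n → ℝ)).restrict (posOrthant n) =
    Measure.pi fun _ => volume.restrict (Set.Ioi 0) := by
  rw [← Measure.restrict_pi_pi, volume_pi]
  congr 1
  ext x
  simp [posOrthant]

open Classical in
/-- The Prékopa–Leindler inequality on the orthant, for the mean that the substitution
`x = y ^ (j + 1)` in all coordinates makes the arithmetic one. -/
theorem prekopa_leindler_posOrthant (j n : ℕ) {u v m : (Fin n → ℝ) → ℝ≥0∞}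
    (hm : AEMeasurable m (volume.restrict (posOrthant n)))
    (h : ∀ z η : Fin n → ℝ, (∀ i, 0 < z i) → (∀ i, |η i| < 1) →
      u (fun i => z i * (1 + η i) ^ (j + 1)) * v (fun i => z i * (1 - η i) ^ (j + 1)) *
        ∏ i, ENNReal.ofReal ((1 - η i ^ 2) ^ j) ≤ m z ^ 2) :
    (∫⁻ x in posOrthant n, u x) * ∫⁻ x in posOrthant n, v x ≤
      (∫⁻ x in posOrthant n, m x) ^ 2 := by
  -- The hypothesis is pointwise, so the measurable replacements must respect it everywhere:
  -- minorants of `u` and `v`, and a majorant of `m` that is `∞` on a null set.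
  obtain ⟨u', hu', huu, hu_eq⟩ := exists_measurable_le_lintegral_eq (volume.restrict (posOrthant n)) u
  obtain ⟨v', hv', hvv, hv_eq⟩ := exists_measurable_le_lintegral_eq (volume.restrict (posOrthant n)) v
  obtain ⟨m', hm', hmm, hm_eq⟩ : ∃ m', Measurable m' ∧ m ≤ m' ∧
      ∫⁻ x in posOrthant n, m' x = ∫⁻ x in posOrthant n, m x := by
    obtain ⟨s, hsub, hs, hs0⟩ := exists_measurable_superset_of_null
      (ae_iff.1 hm.ae_eq_mk)
    refine ⟨s.piecewise (fun _ => ∞) (hm.mk m), measurable_const.piecewise hs hm.measurable_mk,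
      fun x => ?_, ?_⟩
    · by_cases hx : x ∈ s
      · simp [hx]
      · rw [Set.piecewise_eq_of_notMem _ _ _ hx]
        by_contra hne
        exact hx (hsub fun heq => hne heq.le)
    · refine lintegral_congr_ae ?_
      filter_upwards [measure_eq_zero_iff_ae_notMem.1 hs0, hm.ae_eq_mk] with x hx hx'
      rw [Set.piecewise_eq_of_notMem _ _ _ hx, hx']
  rw [hu_eq, hv_eq, ← hm_eq, restrict_posOrthant]
  refine prekopa_leindler_pi j n hu' hv' hm' fun z η hz hη => le_trans ?_ ((h z η hz hη).trans ?_)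
  · gcongr
    · exact huu _
    · exact hvv _
  · gcongr
    exact hmm _

/-! ### Second-order expansion of an inequality between exponential integrals -/

theorem abs_exp_sub_quadratic_le {s : ℝ} (hs : |s| ≤ 1) :
    |Real.exp s - (1 + s + s ^ 2 / 2)| ≤ |s| ^ 3 := by
  have := Real.exp_bound hs (n := 3) (by norm_num)
  simp only [Finset.sum_range_succ, Finset.sum_range_zero, Nat.factorial] at this
  norm_num at this
  exact this.trans (by nlinarith [pow_nonneg (abs_nonneg s) 3])

theorem quadratic_le_exp {e y B : ℝ} (he : 0 < e) (heB : 2 * (e * B) ≤ 1) (hy : |y| ≤ B) :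
    (1 - 8 * e ^ 3 * B ^ 3) + 2 * e * y + 2 * e ^ 2 * y ^ 2 ≤ Real.exp (2 * e * y) := by
  have hs : |2 * e * y| ≤ 2 * (e * B) := by
    rw [abs_mul, abs_of_pos (by positivity), mul_assoc]
    gcongr
  have h1 := (abs_le.1 (abs_exp_sub_quadratic_le (hs.trans heB))).1
  have h2 : |2 * e * y| ^ 3 ≤ (2 * (e * B)) ^ 3 := pow_le_pow_left₀ (abs_nonneg _) hs 3
  have h3 : (2 * (e * B)) ^ 3 = 8 * e ^ 3 * B ^ 3 := by ring
  have h4 : (2 * e * y) ^ 2 / 2 = 2 * e ^ 2 * y ^ 2 := by ring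
  linarith

/-- The argument has size at most `e * B`, so the Taylor remainder costs `e ^ 3 * B ^ 3`. The terms
of the square that involve `d` are of order `e ^ 3` and cost the same again. -/
theorem exp_le_quadratic {e y d N C B : ℝ} (he : 0 < e) (hB : B = N + C + 1)
    (heB : 2 * (e * B) ≤ 1) (hy : |y| ≤ N) (hd : |d| ≤ C) :
    |e * y + e ^ 2 * d| ≤ 1 ∧ Real.exp (e * y + e ^ 2 * d) ≤
      (1 + 2 * e ^ 3 * B ^ 3) + e * y + e ^ 2 * d + e ^ 2 / 2 * y ^ 2 := by
  have hN0 : 0 ≤ N := (abs_nonneg _).trans hy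
  have hC0 : 0 ≤ C := (abs_nonneg _).trans hd
  have hB1 : 1 ≤ B := by linarith
  have he1 : e ≤ 1 := by nlinarith
  have hs : |e * y + e ^ 2 * d| ≤ e * B := by
    calc |e * y + e ^ 2 * d| ≤ |e * y| + |e ^ 2 * d| := abs_add_le _ _
      _ = e * |y| + e ^ 2 * |d| := by
          rw [abs_mul, abs_mul, abs_of_pos he, abs_of_pos (pow_pos he 2)]
      _ ≤ e * N + e ^ 2 * C := by gcongr
      _ ≤ e * N + e * C := by
          have : e ^ 2 ≤ e := by nlinarith
          gcongr
      _ ≤ e * B := by rw [hB]; nlinarith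
  have hs1 : |e * y + e ^ 2 * d| ≤ 1 := by linarith [mul_pos he (zero_lt_one.trans_le hB1)]
  refine ⟨hs1, ?_⟩
  have h1 := (abs_le.1 (abs_exp_sub_quadratic_le hs1)).2
  have h2 : |e * y + e ^ 2 * d| ^ 3 ≤ (e * B) ^ 3 := pow_le_pow_left₀ (abs_nonneg _) hs 3
  have h4 : y * d ≤ N * C := by
    calc y * d ≤ |y| * |d| := by rw [← abs_mul]; exact le_abs_self _
      _ ≤ N * C := by gcongr
  have h5 : d ^ 2 ≤ C ^ 2 := by rw [← sq_abs]; gcongr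
  have h6 : e * d ^ 2 ≤ 1 * C ^ 2 := by gcongr
  have h7 : N * C + C ^ 2 ≤ B ^ 2 := by
    have : B ^ 2 = (N * C + C ^ 2) + (N ^ 2 + N * C + 2 * N + 2 * C + 1) := by rw [hB]; ring
    have : 0 ≤ N ^ 2 + N * C + 2 * N + 2 * C + 1 := by positivity
    linarith
  have h8 : B ^ 2 ≤ B ^ 3 := pow_le_pow_right₀ hB1 (by norm_num)
  have h9 : 2 * (y * d) + e * d ^ 2 ≤ 2 * B ^ 3 := by linarith [sq_nonneg C]
  have h10 : e ^ 3 * (2 * (y * d) + e * d ^ 2) ≤ e ^ 3 * (2 * B ^ 3) := by gcongr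
  have h11 : (e * y + e ^ 2 * d) ^ 2 / 2 =
      e ^ 2 / 2 * y ^ 2 + e ^ 3 * (2 * (y * d) + e * d ^ 2) / 2 := by ring
  have h12 : (e * B) ^ 3 = e ^ 3 * B ^ 3 := by ring
  linarith

open Filter Topology in
/-- Second-order consequence of an integrated inequality between exponentials. -/
theorem variance_le_of_forall_exp_le {X : Type*} [MeasurableSpace X] {ν : Measure X}
    [IsFiniteMeasure ν] {f G : X → ℝ} {D : ℕ → X → ℝ} {ε : ℕ → ℝ} {N C : ℝ}
    (hf : AEMeasurable f ν) (hD : ∀ m, AEMeasurable (D m) ν)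
    (hfN : ∀ᵐ x ∂ν, |f x| ≤ N) (hDC : ∀ m, ∀ᵐ x ∂ν, |D m x| ≤ C)
    (hDG : ∀ᵐ x ∂ν, Tendsto (fun m => D m x) atTop (𝓝 (G x)))
    (hε0 : ∀ m, 0 < ε m) (hε : Tendsto ε atTop (𝓝 0))
    (h : ∀ m, ν.real Set.univ * ∫ x, Real.exp (2 * ε m * f x) ∂ν ≤
      (∫ x, Real.exp (ε m * f x + ε m ^ 2 * D m x) ∂ν) ^ 2) :
    ν.real Set.univ * ∫ x, f x ^ 2 ∂ν ≤
      (∫ x, f x ∂ν) ^ 2 + 2 * ν.real Set.univ * ∫ x, G x ∂ν := by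
  rcases eq_or_ne ν 0 with rfl | hν
  · simp
  have : (ae ν).NeBot := ae_neBot.2 hν
  have hN0 : 0 ≤ N := by
    obtain ⟨x, hx⟩ := hfN.exists
    exact (abs_nonneg _).trans hx
  have hC0 : 0 ≤ C := by
    obtain ⟨x, hx⟩ := (hDC 0).exists
    exact (abs_nonneg _).trans hx
  set c := ν.real Set.univ with hc
  set a := ∫ x, f x ∂ν with ha
  set b := ∫ x, f x ^ 2 ∂ν with hb
  set B := N + C + 1 with hB
  have hB1 : 1 ≤ B := by linarith
  have hint_f : Integrable f ν := Integrable.of_bound hf.aestronglyMeasurable N hfN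
  have hint_f2 : Integrable (fun x => f x ^ 2) ν :=
    Integrable.of_bound (hf.pow_const 2).aestronglyMeasurable (N ^ 2) (hfN.mono fun x hx => by
      rw [Real.norm_eq_abs, abs_pow]; gcongr)
  have hint_D : ∀ m, Integrable (D m) ν := fun m =>
    Integrable.of_bound (hD m).aestronglyMeasurable C (hDC m)
  have hd : Tendsto (fun m => ∫ x, D m x ∂ν) atTop (𝓝 (∫ x, G x ∂ν)) :=
    tendsto_integral_of_dominated_convergence (fun _ => C) (fun m => (hD m).aestronglyMeasurable)
      (integrable_const C) hDC hDG
  -- `c + ε m * p m` is the upper bound for the integral on the right, and `p` tends to `a`; its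
  -- square yields the term `a ^ 2` in the limit.
  set p : ℕ → ℝ := fun m => a + ε m * (∫ x, D m x ∂ν + b / 2) + 2 * ε m ^ 2 * B ^ 3 * c with hp
  have hplim : Tendsto p atTop (𝓝 a) := by
    have := ((tendsto_const_nhds (x := a)).add (hε.mul (hd.add_const (b / 2)))).add
      ((((hε.pow 2).const_mul 2).mul_const (B ^ 3)).mul_const c)
    simpa using this
  -- The orders `1` and `ε` cancel, and division by `ε²` leaves this. The constant `12` is `8` from
  -- the lower bound plus `2 * 2` from the cross term of the squared upper bound.
  have hbound : ∀ᶠ m in atTop, c * b ≤ 2 * c * ∫ x, D m x ∂ν + p m ^ 2 + 12 * ε m * B ^ 3 * c ^ 2 := by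
    have hsmall : ∀ᶠ m in atTop, ε m < 1 / (2 * B) := hε.eventually_lt_const (by positivity)
    filter_upwards [hsmall] with m hm
    set e := ε m with he
    have he0 : 0 < e := hε0 m
    have heB : 2 * (e * B) < 1 := by
      rw [lt_div_iff₀ (by positivity)] at hm; linarith
    have hlow : c + 2 * e * a + 2 * e ^ 2 * b - 8 * e ^ 3 * B ^ 3 * c ≤
        ∫ x, Real.exp (2 * e * f x) ∂ν := by
      have hi1 : Integrable (fun x => (1 - 8 * e ^ 3 * B ^ 3) + 2 * e * f x) ν :=
        (integrable_const _).add (hint_f.const_mul _)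
      have hi : Integrable (fun x => (1 - 8 * e ^ 3 * B ^ 3) + 2 * e * f x + 2 * e ^ 2 * f x ^ 2) ν :=
        hi1.add (hint_f2.const_mul _)
      have : ∫ x, ((1 - 8 * e ^ 3 * B ^ 3) + 2 * e * f x + 2 * e ^ 2 * f x ^ 2) ∂ν =
          c + 2 * e * a + 2 * e ^ 2 * b - 8 * e ^ 3 * B ^ 3 * c := by
        rw [integral_add hi1 (hint_f2.const_mul _),
          integral_add (integrable_const _) (hint_f.const_mul _), integral_const,
          integral_const_mul, integral_const_mul, smul_eq_mul]
        ring
      rw [← this]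
      refine integral_mono_ae hi ?_ ?_
      · refine Integrable.of_bound
          (Real.measurable_exp.comp_aemeasurable (hf.const_mul _)).aestronglyMeasurable
          (Real.exp 1) (hfN.mono fun x hx => ?_)
        rw [Real.norm_eq_abs, Real.abs_exp]
        refine Real.exp_le_exp.2 ?_
        have h1 : e * f x ≤ e * B := by
          gcongr
          linarith [le_abs_self (f x)]
        linarith
      · exact hfN.mono fun x hx => quadratic_le_exp he0 heB.le (by linarith)
    have hup : ∫ x, Real.exp (e * f x + e ^ 2 * D m x) ∂ν ≤ c + e * p m := by
      have hi1 : Integrable (fun x => (1 + 2 * e ^ 3 * B ^ 3) + e * f x) ν :=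
        (integrable_const _).add (hint_f.const_mul _)
      have hi2 : Integrable (fun x => (1 + 2 * e ^ 3 * B ^ 3) + e * f x + e ^ 2 * D m x) ν :=
        hi1.add ((hint_D m).const_mul _)
      have hi : Integrable (fun x => (1 + 2 * e ^ 3 * B ^ 3) + e * f x + e ^ 2 * D m x +
          e ^ 2 / 2 * f x ^ 2) ν :=
        hi2.add (hint_f2.const_mul _)
      have : ∫ x, ((1 + 2 * e ^ 3 * B ^ 3) + e * f x + e ^ 2 * D m x + e ^ 2 / 2 * f x ^ 2) ∂ν =
          c + e * p m := by
        rw [integral_add hi2 (hint_f2.const_mul _), integral_add hi1 ((hint_D m).const_mul _),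
          integral_add (integrable_const _) (hint_f.const_mul _), integral_const,
          integral_const_mul, integral_const_mul, integral_const_mul, smul_eq_mul]
        simp only [hp]
        ring
      rw [← this]
      have hs : ∀ᵐ x ∂ν, |e * f x + e ^ 2 * D m x| ≤ 1 ∧ Real.exp (e * f x + e ^ 2 * D m x) ≤
          (1 + 2 * e ^ 3 * B ^ 3) + e * f x + e ^ 2 * D m x + e ^ 2 / 2 * f x ^ 2 := by
        filter_upwards [hfN, hDC m] with x hx hx'
        exact exp_le_quadratic he0 hB heB.le hx hx'
      refine integral_mono_ae ?_ hi (hs.mono fun x hx => hx.2)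
      refine Integrable.of_bound (Real.measurable_exp.comp_aemeasurable
        ((hf.const_mul _).add ((hD m).const_mul _))).aestronglyMeasurable
        (Real.exp 1) (hs.mono fun x hx => ?_)
      rw [Real.norm_eq_abs, Real.abs_exp]
      exact Real.exp_le_exp.2 ((le_abs_self _).trans hx.1)
    have hI0 : 0 ≤ ∫ x, Real.exp (e * f x + e ^ 2 * D m x) ∂ν :=
      integral_nonneg fun x => (Real.exp_pos _).le
    have hc0 : 0 ≤ c := measureReal_nonneg
    have hm' := h m
    have h1 : c * (c + 2 * e * a + 2 * e ^ 2 * b - 8 * e ^ 3 * B ^ 3 * c) ≤ (c + e * p m) ^ 2 :=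
      (mul_le_mul_of_nonneg_left hlow hc0).trans (hm'.trans (by gcongr))
    have h2 : e * p m = e * a + e ^ 2 * (∫ x, D m x ∂ν + b / 2) + 2 * e ^ 3 * B ^ 3 * c := by
      simp only [hp]; ring
    have h3 : e ^ 2 * (c * b) ≤
        e ^ 2 * (2 * c * ∫ x, D m x ∂ν + p m ^ 2 + 12 * e * B ^ 3 * c ^ 2) := by
      have h4 : (c + e * p m) ^ 2 = c ^ 2 + 2 * c * (e * p m) + e ^ 2 * p m ^ 2 := by ring
      rw [h4, h2] at h1
      linarith
    exact le_of_mul_le_mul_left h3 (by positivity)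
  refine ge_of_tendsto ?_ hbound
  have := (((hd.const_mul (2 * c)).add (hplim.pow 2)).add
    (((hε.const_mul 12).mul_const (B ^ 3)).mul_const (c ^ 2)))
  simp only [mul_zero, zero_mul, add_zero] at this
  rw [add_comm (a ^ 2)]
  exact this

/-! ### The sup-convolution and its small-parameter asymptotics -/

/-- The exponential of the sup-convolution of `ε f` with the convexity gap of `-j log` in the
coordinates `y`, `x = y ^ (j + 1)`. -/
noncomputable def expSupConv (j : ℕ) {n : ℕ} (f : (Fin n → ℝ) → ℝ) (ε : ℝ) (z : Fin n → ℝ) :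
    ℝ≥0∞ :=
  ⨆ η : {η : Fin n → ℝ // ∀ i, |η i| < 1}, ENNReal.ofReal (Real.exp
    (ε * f (fun i => z i * (1 + η.1 i) ^ (j + 1)) + j / 2 * ∑ i, Real.log (1 - η.1 i ^ 2)))

/-- The supremum is over an uncountable family; it is measurable because a supremum of continuous
functions is lower semicontinuous. -/
theorem measurable_expSupConv (j : ℕ) {n : ℕ} {f : (Fin n → ℝ) → ℝ} (hf : Continuous f) (ε : ℝ) :
    Measurable (expSupConv j f ε) := by
  refine LowerSemicontinuous.measurable (lowerSemicontinuous_iSup fun η => ?_)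
  refine Continuous.lowerSemicontinuous (ENNReal.continuous_ofReal.comp (Real.continuous_exp.comp ?_))
  exact (continuous_const.mul (hf.comp (by fun_prop))).add continuous_const

theorem le_expSupConv (j : ℕ) {n : ℕ} (f : (Fin n → ℝ) → ℝ) (ε : ℝ) (z : Fin n → ℝ)
    {η : Fin n → ℝ} (hη : ∀ i, |η i| < 1) :
    ENNReal.ofReal (Real.exp (ε * f (fun i => z i * (1 + η i) ^ (j + 1)) +
      j / 2 * ∑ i, Real.log (1 - η i ^ 2))) ≤ expSupConv j f ε z :=
  le_iSup (fun η : {η : Fin n → ℝ // ∀ i, |η i| < 1} => ENNReal.ofReal (Real.exp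
    (ε * f (fun i => z i * (1 + η.1 i) ^ (j + 1)) + j / 2 * ∑ i, Real.log (1 - η.1 i ^ 2)))) ⟨η, hη⟩

theorem one_sub_sq_pos_of_abs_lt {t : ℝ} (h : |t| < 1) : 0 < 1 - t ^ 2 := by
  have := (sq_lt_one_iff_abs_lt_one t).2 h
  linarith

/-- By `log (1 - t²) ≤ -t²`, the logarithmic penalty is at least as strong as the quadratic one. -/
theorem expSupConv_le (j : ℕ) {n : ℕ} (f : (Fin n → ℝ) → ℝ) (ε : ℝ) (z : Fin n → ℝ) {B : ℝ}
    (h : ∀ η : Fin n → ℝ, (∀ i, |η i| < 1) →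
      ε * f (fun i => z i * (1 + η i) ^ (j + 1)) ≤ B + ∑ i, j / 2 * η i ^ 2) :
    expSupConv j f ε z ≤ ENNReal.ofReal (Real.exp B) := by
  refine iSup_le fun η => ENNReal.ofReal_le_ofReal (Real.exp_le_exp.2 ?_)
  have h1 : j / 2 * ∑ i, Real.log (1 - η.1 i ^ 2) ≤ ∑ i, -((j : ℝ) / 2 * η.1 i ^ 2) := by
    rw [Finset.mul_sum]
    refine Finset.sum_le_sum fun i _ => ?_
    rw [← mul_neg]
    refine mul_le_mul_of_nonneg_left ?_ (by positivity)
    have := Real.log_le_sub_one_of_pos (one_sub_sq_pos_of_abs_lt (η.2 i))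
    linarith
  rw [Finset.sum_neg_distrib] at h1
  linarith [h η.1 η.2]

theorem abs_one_add_pow_sub_one_le {η : ℝ} (h : |η| ≤ 1) (m : ℕ) :
    |(1 + η) ^ m - 1| ≤ m * 2 ^ m * |η| := by
  induction m with
  | zero => simp
  | succ m ih =>
    have h1 : |1 + η| ≤ 2 := (abs_add_le _ _).trans (by rw [abs_one]; linarith)
    have h2 : (1 : ℝ) ≤ 2 ^ (m + 1) := one_le_pow₀ (by norm_num)
    calc |(1 + η) ^ (m + 1) - 1| = |(1 + η) * ((1 + η) ^ m - 1) + η| := by congr 1; ring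
      _ ≤ |1 + η| * |(1 + η) ^ m - 1| + |η| := by
          rw [← abs_mul]; exact abs_add_le _ _
      _ ≤ 2 * (m * 2 ^ m * |η|) + 2 ^ (m + 1) * |η| := by
          gcongr
          nlinarith [abs_nonneg η]
      _ = _ := by push_cast; ring

/-- A locally Lipschitz function is Lipschitz along bounded multiplicative perturbations. -/
theorem LocallyLipschitz.exists_abs_sub_le_sum (j : ℕ) {n : ℕ} {f : (Fin n → ℝ) → ℝ}
    (hf : LocallyLipschitz f) (R : ℝ) :
    ∃ L : ℝ, 0 ≤ L ∧ ∀ z η : Fin n → ℝ, (∀ i, 0 < z i) → (∀ i, z i ≤ R) → (∀ i, |η i| < 1) →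
      |f (fun i => z i * (1 + η i) ^ (j + 1)) - f z| ≤ L * ∑ i, |η i| := by
  obtain ⟨K, hK⟩ := LocallyLipschitzOn.exists_lipschitzOnWith_of_compact
    (isCompact_Icc (a := (0 : Fin n → ℝ)) (b := fun _ => R * 2 ^ (j + 1)))
    hf.locallyLipschitzOn
  refine ⟨K * (|R| * ((j + 1 : ℕ) * 2 ^ (j + 1))), by positivity, fun z η hz hzR hη => ?_⟩
  have hz' : z ∈ Set.Icc (0 : Fin n → ℝ) (fun _ => R * 2 ^ (j + 1)) := by
    refine ⟨fun i => (hz i).le, fun i => ?_⟩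
    have h1 : (1 : ℝ) ≤ 2 ^ (j + 1) := one_le_pow₀ (by norm_num)
    have h2 := hzR i
    have h3 := hz i
    show z i ≤ R * 2 ^ (j + 1)
    nlinarith
  have hx' : (fun i => z i * (1 + η i) ^ (j + 1)) ∈
      Set.Icc (0 : Fin n → ℝ) (fun _ => R * 2 ^ (j + 1)) := by
    refine ⟨fun i => ?_, fun i => ?_⟩
    · have := (abs_lt.1 (hη i)).1
      exact mul_nonneg (hz i).le (pow_nonneg (by linarith) _)
    · have h1 := (abs_lt.1 (hη i)).1
      have h2 := (abs_lt.1 (hη i)).2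
      have h3 := hz i
      show z i * (1 + η i) ^ (j + 1) ≤ R * 2 ^ (j + 1)
      have h4 := hzR i
      exact mul_le_mul h4 (pow_le_pow_left₀ (by linarith) (by linarith) _)
        (pow_nonneg (by linarith) _) (h3.le.trans h4)
  have h1 := hK.dist_le_mul _ hx' _ hz'
  rw [Real.dist_eq] at h1
  refine h1.trans ?_
  rw [mul_assoc]
  refine mul_le_mul_of_nonneg_left ?_ K.2
  have hsum : ∀ i, |η i| ≤ ∑ i, |η i| := fun i =>
    Finset.single_le_sum (f := fun i => |η i|) (fun i _ => abs_nonneg _) (Finset.mem_univ i)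
  refine (dist_pi_le_iff (mul_nonneg (by positivity)
    (Finset.sum_nonneg fun i _ => abs_nonneg _))).2 fun i => ?_
  rw [Real.dist_eq]
  calc |z i * (1 + η i) ^ (j + 1) - z i| = |z i| * |(1 + η i) ^ (j + 1) - 1| := by
        rw [← abs_mul]; congr 1; ring
    _ ≤ |R| * ((j + 1 : ℕ) * 2 ^ (j + 1) * |η i|) := by
        gcongr
        · exact (hz i).le
        · exact hzR i
        · exact abs_one_add_pow_sub_one_le (hη i).le _
    _ ≤ |R| * ((j + 1 : ℕ) * 2 ^ (j + 1) * ∑ i, |η i|) := by gcongr; exact hsum i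
    _ = _ := by ring

open Filter Topology in
theorem LocallyLipschitz.ae_differentiableAt {n : ℕ} {f : (Fin n → ℝ) → ℝ}
    (hf : LocallyLipschitz f) : ∀ᵐ x, DifferentiableAt ℝ f x := by
  have h : ∀ N : ℕ, ∀ᵐ x, x ∈ Metric.closedBall (0 : Fin n → ℝ) N →
      DifferentiableWithinAt ℝ f (Metric.closedBall (0 : Fin n → ℝ) N) x := fun N => by
    obtain ⟨K, hK⟩ := LocallyLipschitzOn.exists_lipschitzOnWith_of_compact
      (isCompact_closedBall (0 : Fin n → ℝ) (N : ℝ)) hf.locallyLipschitzOn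
    exact hK.ae_differentiableWithinAt_of_mem
  filter_upwards [ae_all_iff.2 h] with x hx
  obtain ⟨N, hN⟩ := exists_nat_gt ‖x‖
  have hmem : Metric.closedBall (0 : Fin n → ℝ) N ∈ 𝓝 x :=
    mem_of_superset (Metric.isOpen_ball.mem_nhds (by simpa using hN)) Metric.ball_subset_closedBall
  exact (hx N (by simpa using hN.le)).differentiableAt hmem

/-- The quadratic form of the gradient in the weighted Poincaré inequality. -/
noncomputable def weightedGradSq (j : ℕ) {n : ℕ} (f : (Fin n → ℝ) → ℝ) (z : Fin n → ℝ) : ℝ :=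
  ∑ i, ((j : ℝ) + 1) ^ 2 / (2 * j) * z i ^ 2 * partialDeriv i f z ^ 2

theorem weightedGradSq_nonneg (j : ℕ) {n : ℕ} (f : (Fin n → ℝ) → ℝ) (z : Fin n → ℝ) :
    0 ≤ weightedGradSq j f z :=
  Finset.sum_nonneg fun i _ => by positivity

theorem measurable_partialDeriv {n : ℕ} {f : (Fin n → ℝ) → ℝ} (hf : Continuous f) (i : Fin n) :
    Measurable (partialDeriv i f) :=
  measurable_lineDeriv hf

theorem measurable_weightedGradSq (j : ℕ) {n : ℕ} {f : (Fin n → ℝ) → ℝ} (hf : Continuous f) :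
    Measurable (weightedGradSq j f) :=
  Finset.measurable_sum _ fun i _ =>
    ((measurable_pi_apply i).pow_const 2 |>.const_mul _).mul ((measurable_partialDeriv hf i).pow_const 2)

theorem mul_le_sq_add_sq {j : ℝ} (hj : 0 < j) (A t : ℝ) : A * t ≤ A ^ 2 / (2 * j) + j / 2 * t ^ 2 := by
  have : A ^ 2 / (2 * j) + j / 2 * t ^ 2 - A * t = (A - j * t) ^ 2 / (2 * j) := by
    field_simp; ring
  have : 0 ≤ (A - j * t) ^ 2 / (2 * j) := by positivity
  linarith

/-- Completing the square in each coordinate against the quadratic penalty. The coefficient of `ε ^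
2` does not depend on `ε`, which supplies the bound for dominated convergence. -/
theorem expSupConv_le_of_lipschitz {j : ℕ} (hj : 0 < j) {n : ℕ} {f : (Fin n → ℝ) → ℝ}
    {z : Fin n → ℝ} {L ε : ℝ} (hε : 0 < ε)
    (hL : ∀ η : Fin n → ℝ, (∀ i, |η i| < 1) →
      |f (fun i => z i * (1 + η i) ^ (j + 1)) - f z| ≤ L * ∑ i, |η i|) :
    expSupConv j f ε z ≤
      ENNReal.ofReal (Real.exp (ε * f z + ε ^ 2 * (n * (L ^ 2 / (2 * j))))) := by
  refine expSupConv_le j f ε z fun η hη => ?_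
  have hj' : (0 : ℝ) < j := by exact_mod_cast hj
  have h1 : f (fun i => z i * (1 + η i) ^ (j + 1)) ≤ f z + L * ∑ i, |η i| := by
    linarith [le_abs_self (f (fun i => z i * (1 + η i) ^ (j + 1)) - f z), hL η hη]
  have h2 : ε * f (fun i => z i * (1 + η i) ^ (j + 1)) ≤ ε * (f z + L * ∑ i, |η i|) := by gcongr
  have h3 : ε * L * ∑ i, |η i| ≤ ∑ i, ((ε * L) ^ 2 / (2 * j) + j / 2 * η i ^ 2) := by
    rw [Finset.mul_sum]
    refine Finset.sum_le_sum fun i _ => ?_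
    simpa using mul_le_sq_add_sq hj' (ε * L) |η i|
  rw [Finset.sum_add_distrib, Finset.sum_const, Finset.card_univ, Fintype.card_fin,
    nsmul_eq_mul] at h3
  have h4 : ε ^ 2 * (n * (L ^ 2 / (2 * j))) = n * ((ε * L) ^ 2 / (2 * j)) := by ring
  linarith

-- The sharp form at a point of differentiability. For small `η` the first-order expansion of `f (z
-- (1 + η) ^ (j + 1))`, with its error absorbed in a slope increase `d`, is optimised against the
-- quadratic penalty. For larger `η` the penalty alone outweighs the gain once `ε` is small.
open Filter Topology in
theorem exists_expSupConv_le {j : ℕ} (hj : 0 < j) {n : ℕ} {f : (Fin n → ℝ) → ℝ}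
    {z : Fin n → ℝ} (hf : DifferentiableAt ℝ f z) {L : ℝ} (hL0 : 0 ≤ L)
    (hL : ∀ η : Fin n → ℝ, (∀ i, |η i| < 1) →
      |f (fun i => z i * (1 + η i) ^ (j + 1)) - f z| ≤ L * ∑ i, |η i|) {δ : ℝ} (hδ : 0 < δ) :
    ∃ ε₀ > 0, ∀ ε, 0 < ε → ε < ε₀ → expSupConv j f ε z ≤
      ENNReal.ofReal (Real.exp (ε * f z + ε ^ 2 * (weightedGradSq j f z + δ))) := by
  have hj' : (0 : ℝ) < j := by exact_mod_cast hj
  set A : Fin n → ℝ := fun i => |((j : ℝ) + 1) * z i * partialDeriv i f z| with hA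
  obtain ⟨d, hd0, hd⟩ : ∃ d > 0, ∑ i, (A i + d) ^ 2 / (2 * j) < weightedGradSq j f z + δ := by
    have hc : Continuous fun d : ℝ => ∑ i, (A i + d) ^ 2 / (2 * j) := by fun_prop
    have h0 : ∑ i, (A i + 0) ^ 2 / (2 * (j : ℝ)) < weightedGradSq j f z + δ := by
      have : ∑ i, (A i + 0) ^ 2 / (2 * (j : ℝ)) = weightedGradSq j f z := by
        refine Finset.sum_congr rfl fun i _ => ?_
        simp only [hA, add_zero, sq_abs]
        ring
      rw [this]; linarith
    have h1 : ∀ᶠ d in 𝓝[>] (0 : ℝ), ∑ i, (A i + d) ^ 2 / (2 * j) < weightedGradSq j f z + δ :=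
      nhdsWithin_le_nhds (hc.continuousAt.eventually_lt_const h0)
    obtain ⟨d, hd, hd0⟩ := (h1.and self_mem_nhdsWithin).exists
    exact ⟨d, hd0, hd⟩
  obtain ⟨r, hr0, hr⟩ : ∃ r > 0, ∀ η : Fin n → ℝ, ‖η‖ < r →
      f (fun i => z i * (1 + η i) ^ (j + 1)) ≤ f z + ∑ i, (A i + d) * |η i| := by
    set T : (Fin n → ℝ) → (Fin n → ℝ) := fun η i => z i * (1 + η i) ^ (j + 1) with hT
    have hT0 : T 0 = z := by ext i; simp [hT]
    have hTd : HasFDerivAt T (ContinuousLinearMap.pi fun i =>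
        (((j : ℝ) + 1) * z i) • ContinuousLinearMap.proj (R := ℝ) (φ := fun _ : Fin n => ℝ) i) 0 := by
      rw [hasFDerivAt_pi]
      intro i
      have h1 : HasDerivAt (fun t : ℝ => z i * (1 + t) ^ (j + 1)) (((j : ℝ) + 1) * z i) 0 := by
        have := (((hasDerivAt_id (0 : ℝ)).const_add 1).pow (j + 1)).const_mul (z i)
        refine this.congr_deriv ?_
        simp only [id_eq, add_zero, one_pow, Nat.add_sub_cancel, Nat.cast_add, Nat.cast_one]
        ring
      have h2 := (ContinuousLinearMap.proj (R := ℝ) (φ := fun _ : Fin n => ℝ) i).hasFDerivAt (x := 0)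
      exact HasDerivAt.comp_hasFDerivAt (f := fun η : Fin n → ℝ => η i) (0 : Fin n → ℝ) (h₂ := fun t : ℝ => z i * (1 + t) ^ (j + 1)) h1 h2
    have hfT : HasFDerivAt (f ∘ T) _ 0 := HasFDerivAt.comp 0 (by rw [hT0]; exact hf.hasFDerivAt) hTd
    have hlo := hfT.isLittleO.def hd0
    obtain ⟨r, hr0, hr⟩ := Metric.eventually_nhds_iff.1 hlo
    refine ⟨r, hr0, fun η hη => ?_⟩
    have h1 := hr (y := η) (by simpa using hη)
    rw [sub_zero, Real.norm_eq_abs, Function.comp_apply, Function.comp_apply, hT0] at h1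
    have h2 := (le_abs_self _).trans h1
    have h3 : ‖η‖ ≤ ∑ i, |η i| := by
      refine (pi_norm_le_iff_of_nonneg (Finset.sum_nonneg fun i _ => abs_nonneg _)).2 fun i => ?_
      exact Finset.single_le_sum (f := fun i => |η i|) (fun i _ => abs_nonneg _) (Finset.mem_univ i)
    have h4 : ((fderiv ℝ f z).comp (ContinuousLinearMap.pi fun i =>
        (((j : ℝ) + 1) * z i) • ContinuousLinearMap.proj (R := ℝ) (φ := fun _ : Fin n => ℝ) i)) η ≤
        ∑ i, A i * |η i| := by
      rw [ContinuousLinearMap.comp_apply, pi_eq_sum_univ' (ContinuousLinearMap.pi (fun i =>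
        (((j : ℝ) + 1) * z i) • ContinuousLinearMap.proj (R := ℝ) (φ := fun _ : Fin n => ℝ) i) η),
        map_sum]
      refine Finset.sum_le_sum fun i _ => ?_
      rw [map_smul]
      have h5 : fderiv ℝ f z (Pi.single i 1) = partialDeriv i f z :=
        (hf.lineDeriv_eq_fderiv).symm
      rw [h5, hA]
      simp only [ContinuousLinearMap.coe_pi', _root_.smul_apply,
        ContinuousLinearMap.proj_apply, smul_eq_mul]
      rw [← abs_mul]
      refine le_trans (le_of_eq ?_) (le_abs_self _)
      ring
    have h5 : ∑ i, (A i + d) * |η i| = ∑ i, A i * |η i| + d * ∑ i, |η i| := by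
      rw [Finset.mul_sum, ← Finset.sum_add_distrib]
      exact Finset.sum_congr rfl fun i _ => by ring
    have h6 : d * ‖η‖ ≤ d * ∑ i, |η i| := by gcongr
    have h7 : T η = fun i => z i * (1 + η i) ^ (j + 1) := rfl
    rw [h7] at h2
    linarith
  -- For `‖η‖ ≥ r` the penalty is at least `j * r ^ 2 / 2` and the gain at most `ε * L * n`. The `+
  -- 1` keeps the denominator positive when `n * L = 0`.
  refine ⟨j * r ^ 2 / (2 * n * L + 1), by positivity, fun ε hε hε₀ => ?_⟩
  rw [lt_div_iff₀ (by positivity)] at hε₀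
  refine expSupConv_le j f ε z fun η hη => ?_
  rcases lt_or_ge ‖η‖ r with h | h
  · have h1 : ε * f (fun i => z i * (1 + η i) ^ (j + 1)) ≤ ε * (f z + ∑ i, (A i + d) * |η i|) := by
      gcongr; exact hr η h
    have h2 : ε * ∑ i, (A i + d) * |η i| ≤
        ε ^ 2 * ∑ i, (A i + d) ^ 2 / (2 * j) + ∑ i, j / 2 * η i ^ 2 := by
      rw [Finset.mul_sum, Finset.mul_sum, ← Finset.sum_add_distrib]
      refine Finset.sum_le_sum fun i _ => ?_
      have := mul_le_sq_add_sq hj' (ε * (A i + d)) |η i|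
      rw [sq_abs] at this
      calc _ = ε * (A i + d) * |η i| := by ring
        _ ≤ _ := this
        _ = _ := by ring
    have h3 : ε ^ 2 * ∑ i, (A i + d) ^ 2 / (2 * j) ≤ ε ^ 2 * (weightedGradSq j f z + δ) := by
      gcongr
    linarith
  · have h1 : f (fun i => z i * (1 + η i) ^ (j + 1)) ≤ f z + L * ∑ i, |η i| := by
      linarith [le_abs_self (f (fun i => z i * (1 + η i) ^ (j + 1)) - f z), hL η hη]
    have h2 : ∑ i, |η i| ≤ n := by
      have := Finset.sum_le_sum (s := Finset.univ) fun i _ => (hη i).le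
      simpa using this
    have h3 : j / 2 * r ^ 2 ≤ ∑ i, j / 2 * η i ^ 2 := by
      rw [← Finset.mul_sum]
      refine mul_le_mul_of_nonneg_left ?_ (by positivity)
      by_contra! hlt
      refine absurd h (not_le.2 ((pi_norm_lt_iff hr0).2 fun i => ?_))
      have h5 : η i ^ 2 ≤ ∑ i, η i ^ 2 := Finset.single_le_sum (f := fun i => η i ^ 2)
        (fun i _ => sq_nonneg _) (Finset.mem_univ i)
      exact abs_lt_of_sq_lt_sq (h5.trans_lt hlt) hr0.le
    have h4 : ε * f (fun i => z i * (1 + η i) ^ (j + 1)) ≤ ε * (f z + L * n) := by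
      gcongr
      exact h1.trans (by gcongr)
    have h5 : 0 ≤ ε ^ 2 * (weightedGradSq j f z + δ) :=
      mul_nonneg (sq_nonneg _) (add_nonneg (weightedGradSq_nonneg j f z) hδ.le)
    nlinarith

/-! ### The weighted Poincaré inequality on the orthant -/

/-- Midpoint log-concavity on the orthant in the coordinates `y`, `x = y ^ (j + 1)`. -/
def PowMidLogConcave (j : ℕ) {n : ℕ} (w : (Fin n → ℝ) → ℝ≥0∞) : Prop :=
  ∀ z η : Fin n → ℝ, (∀ i, 0 < z i) → (∀ i, |η i| < 1) →
    w (fun i => z i * (1 + η i) ^ (j + 1)) * w (fun i => z i * (1 - η i) ^ (j + 1)) ≤ w z ^ 2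

theorem measurableSet_posOrthant (n : ℕ) : MeasurableSet (posOrthant n) := by
  have : posOrthant n = Set.univ.pi fun _ => Set.Ioi 0 := by ext x; simp [posOrthant]
  rw [this]
  exact MeasurableSet.univ_pi fun _ => measurableSet_Ioi

/-- The Prékopa–Leindler inequality for an exponential and its sup-convolution. -/
theorem lintegral_exp_mul_le_sq {j n : ℕ} {w : (Fin n → ℝ) → ℝ≥0∞}
    (hw : AEMeasurable w (volume.restrict (posOrthant n))) (hLC : PowMidLogConcave j w)
    {f : (Fin n → ℝ) → ℝ} (hf : Continuous f) (ε : ℝ) :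
    ((volume.restrict (posOrthant n)).withDensity w) Set.univ *
      ∫⁻ x, ENNReal.ofReal (Real.exp (2 * ε * f x))
        ∂((volume.restrict (posOrthant n)).withDensity w) ≤
      (∫⁻ x, expSupConv j f ε x ∂((volume.restrict (posOrthant n)).withDensity w)) ^ 2 := by
  have hexp : Measurable fun x => ENNReal.ofReal (Real.exp (2 * ε * f x)) :=
    (ENNReal.continuous_ofReal.comp (Real.continuous_exp.comp (continuous_const.mul hf))).measurable
  have hM := measurable_expSupConv j hf ε
  rw [mul_comm, lintegral_withDensity_eq_lintegral_mul₀ hw hexp.aemeasurable,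
    lintegral_withDensity_eq_lintegral_mul₀ hw hM.aemeasurable, withDensity_apply _ MeasurableSet.univ,
    Measure.restrict_univ]
  refine prekopa_leindler_posOrthant j n (hw.mul hM.aemeasurable) fun z η hz hη => ?_
  have h1 := hLC z η hz hη
  have h2 := le_expSupConv j f ε z hη
  set x : Fin n → ℝ := fun i => z i * (1 + η i) ^ (j + 1) with hx
  set y : Fin n → ℝ := fun i => z i * (1 - η i) ^ (j + 1) with hy
  -- The square in Prékopa–Leindler accounts for `ε` in place of `2 ε` and for `j / 2` in place of
  -- `j` in the sup-convolution.
  have h3 : ENNReal.ofReal (Real.exp (2 * ε * f x)) * ∏ i, ENNReal.ofReal ((1 - η i ^ 2) ^ j) =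
      ENNReal.ofReal (Real.exp (ε * f x + j / 2 * ∑ i, Real.log (1 - η i ^ 2))) ^ 2 := by
    have h4 : ∏ i, ENNReal.ofReal ((1 - η i ^ 2) ^ j) =
        ENNReal.ofReal (Real.exp (j * ∑ i, Real.log (1 - η i ^ 2))) := by
      rw [← ENNReal.ofReal_prod_of_nonneg fun i _ =>
        pow_nonneg (one_sub_sq_pos_of_abs_lt (hη i)).le _, Finset.mul_sum, Real.exp_sum]
      congr 1
      refine Finset.prod_congr rfl fun i _ => ?_
      rw [Real.exp_nat_mul, Real.exp_log (one_sub_sq_pos_of_abs_lt (hη i))]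
    rw [h4, ← ENNReal.ofReal_mul (Real.exp_pos _).le, ← ENNReal.ofReal_pow (Real.exp_pos _).le,
      ← Real.exp_add, ← Real.exp_nat_mul]
    congr 2
    push_cast
    ring
  simp only [Pi.mul_apply]
  calc w x * ENNReal.ofReal (Real.exp (2 * ε * f x)) * w y *
        ∏ i, ENNReal.ofReal ((1 - η i ^ 2) ^ j)
      = (w x * w y) * (ENNReal.ofReal (Real.exp (2 * ε * f x)) *
        ∏ i, ENNReal.ofReal ((1 - η i ^ 2) ^ j)) := by ring
    _ ≤ w z ^ 2 * expSupConv j f ε z ^ 2 := by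
        rw [h3]
        gcongr
    _ = _ := by ring

open Filter Topology in
/-- The weighted Poincaré inequality for a density supported in `(0, R]ⁿ`. -/
theorem variance_le_of_support_subset {j n : ℕ} (hj : 0 < j) {w : (Fin n → ℝ) → ℝ≥0∞}
    (hw : AEMeasurable w (volume.restrict (posOrthant n))) (hLC : PowMidLogConcave j w)
    {ν : Measure (Fin n → ℝ)} (hν : ν = (volume.restrict (posOrthant n)).withDensity w)
    [IsFiniteMeasure ν] {R : ℝ} (hR : ∀ x, w x ≠ 0 → ∀ i, x i ≤ R)
    {f : (Fin n → ℝ) → ℝ} (hf : LocallyLipschitz f) :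
    ν Set.univ * ∫⁻ x, ENNReal.ofReal (f x ^ 2) ∂ν ≤
      ENNReal.ofReal ((∫ x, f x ∂ν) ^ 2) +
        ν Set.univ * ∫⁻ x, ENNReal.ofReal (2 * weightedGradSq j f x) ∂ν := by
  have hac : ν ≪ volume.restrict (posOrthant n) := hν ▸ withDensity_absolutelyContinuous _ _
  have hO : ∀ᵐ x ∂ν, ∀ i, 0 < x i := hac.ae_le (ae_restrict_mem (measurableSet_posOrthant n))
  have hdiff : ∀ᵐ x ∂ν, DifferentiableAt ℝ f x :=
    hac.ae_le (ae_restrict_of_ae hf.ae_differentiableAt)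
  have hxR : ∀ᵐ x ∂ν, ∀ i, x i ≤ R := by
    rw [hν, ae_withDensity_iff' hw]
    exact ae_of_all _ hR
  obtain ⟨L, hL0, hL⟩ := hf.exists_abs_sub_le_sum j R
  obtain ⟨N, hN⟩ := (isCompact_Icc (a := (0 : Fin n → ℝ)) (b := fun _ => R)).exists_bound_of_continuousOn
    hf.continuous.continuousOn
  have hfN : ∀ᵐ x ∂ν, |f x| ≤ N := by
    filter_upwards [hO, hxR] with x h1 h2
    exact hN x ⟨fun i => (h1 i).le, h2⟩
  set C : ℝ := n * (L ^ 2 / (2 * j)) with hC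
  have hC0 : 0 ≤ C := by positivity
  -- Capping at `C` gives a bounded function without estimating the gradient by the Lipschitz
  -- constant; it only strengthens the conclusion.
  set G : (Fin n → ℝ) → ℝ := fun z => min (weightedGradSq j f z) C with hG
  have hGm : Measurable G := (measurable_weightedGradSq j hf.continuous).min measurable_const
  have hG0 : ∀ z, 0 ≤ G z := fun z => le_min (weightedGradSq_nonneg j f z) hC0
  set ε : ℕ → ℝ := fun m => 1 / ((m : ℝ) + 1) with hε
  have hε0 : ∀ m, 0 < ε m := fun m => Nat.one_div_pos_of_nat
  have hεlim : Tendsto ε atTop (𝓝 0) := tendsto_one_div_add_atTop_nhds_zero_nat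
  -- Chosen so that the sup-convolution is `exp (ε f + ε² q)` wherever it is finite.
  set q : ℕ → (Fin n → ℝ) → ℝ := fun m z =>
    (Real.log (expSupConv j f (ε m) z).toReal - ε m * f z) / ε m ^ 2 with hq
  have hqm : ∀ m, Measurable (q m) := fun m =>
    (((measurable_expSupConv j hf.continuous _).ennreal_toReal.log).sub
      (hf.continuous.measurable.const_mul _)).div_const _
  have hMC : ∀ m, ∀ᵐ x ∂ν, expSupConv j f (ε m) x ≤
      ENNReal.ofReal (Real.exp (ε m * f x + ε m ^ 2 * C)) := fun m => by
    filter_upwards [hO, hxR] with x h1 h2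
    exact expSupConv_le_of_lipschitz hj (hε0 m) fun η hη => hL x η h1 h2 hη
  have hqle : ∀ m x b, expSupConv j f (ε m) x ≤
      ENNReal.ofReal (Real.exp (ε m * f x + ε m ^ 2 * b)) →
      q m x ≤ b ∧ expSupConv j f (ε m) x = ENNReal.ofReal (Real.exp (ε m * f x + ε m ^ 2 * q m x)) := by
    intro m x b hb
    have htop : expSupConv j f (ε m) x ≠ ∞ := ne_top_of_le_ne_top ENNReal.ofReal_ne_top hb
    have hpos : 0 < (expSupConv j f (ε m) x).toReal := by
      refine ENNReal.toReal_pos (ne_of_gt (lt_of_lt_of_le ?_ (le_expSupConv j f (ε m) x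
        (η := 0) (by simp)))) htop
      exact ENNReal.ofReal_pos.2 (Real.exp_pos _)
    have h1 : (expSupConv j f (ε m) x).toReal ≤ Real.exp (ε m * f x + ε m ^ 2 * b) :=
      ENNReal.toReal_le_of_le_ofReal (Real.exp_pos _).le hb
    have h2 := Real.log_le_log hpos h1
    rw [Real.log_exp] at h2
    have hε2 : 0 < ε m ^ 2 := pow_pos (hε0 m) 2
    refine ⟨?_, ?_⟩
    · simp only [hq]
      rw [div_le_iff₀ hε2]
      linarith
    · have h3 : ε m * f x + ε m ^ 2 * q m x = Real.log (expSupConv j f (ε m) x).toReal := by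
        simp only [hq]
        rw [mul_div_cancel₀ _ hε2.ne']
        ring
      rw [h3, Real.exp_log hpos, ENNReal.ofReal_toReal htop]
  -- Only upper bounds on `q` are available. Raising it to at least `G` bounds it below and turns
  -- the asymptotic upper bound into convergence to `G`.
  set D : ℕ → (Fin n → ℝ) → ℝ := fun m z => max (q m z) (G z) with hD
  have hDm : ∀ m, Measurable (D m) := fun m => (hqm m).max hGm
  have hDC : ∀ m, ∀ᵐ x ∂ν, |D m x| ≤ C := fun m => by
    filter_upwards [hMC m] with x hx
    rw [abs_of_nonneg ((hG0 x).trans (le_max_right _ _))]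
    exact max_le (hqle m x C hx).1 (min_le_right _ _)
  have hDG : ∀ᵐ x ∂ν, Tendsto (fun m => D m x) atTop (𝓝 (G x)) := by
    filter_upwards [hO, hxR, hdiff, ae_all_iff.2 hMC] with x h1 h2 h3 h4
    refine tendsto_order.2 ⟨fun b hb => Eventually.of_forall fun m =>
      hb.trans_le (le_max_right _ _), fun b hb => ?_⟩
    obtain ⟨ε₀, hε₀, hle⟩ := exists_expSupConv_le hj h3 hL0 (fun η hη => hL x η h1 h2 hη)
      (δ := (b - G x) / 2) (by linarith)
    filter_upwards [hεlim.eventually_lt_const hε₀] with m hm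
    have h5 := (hqle m x _ (hle (ε m) (hε0 m) hm)).1
    have h6 := (hqle m x _ (h4 m)).1
    have h7 : q m x ≤ G x + (b - G x) / 2 := by
      rcases le_total (weightedGradSq j f x) C with h | h
      · have : G x = weightedGradSq j f x := min_eq_left h
        rw [this] at h5 ⊢; exact h5
      · have : G x = C := min_eq_right h
        linarith
    exact max_lt (by linarith) hb
  have hexpint : ∀ {g : (Fin n → ℝ) → ℝ} {b : ℝ}, Measurable g → (∀ᵐ x ∂ν, g x ≤ b) →
      Integrable (fun x => Real.exp (g x)) ν := fun {g b} hg hb =>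
    Integrable.of_bound hg.exp.aestronglyMeasurable (Real.exp b) (hb.mono fun x hx => by
      rw [Real.norm_eq_abs, Real.abs_exp]; exact Real.exp_le_exp.2 hx)
  have hfm := hf.continuous.measurable
  have key := variance_le_of_forall_exp_le (ν := ν) hfm.aemeasurable
    (fun m => (hDm m).aemeasurable) hfN hDC hDG hε0 hεlim fun m => by
      have hi1 : Integrable (fun x => Real.exp (2 * ε m * f x)) ν :=
        hexpint (b := 2 * ε m * N) (hfm.const_mul _) (hfN.mono fun x hx => by
          have := hε0 m
          have := (abs_le.1 hx).2
          gcongr)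
      have hi2 : Integrable (fun x => Real.exp (ε m * f x + ε m ^ 2 * D m x)) ν :=
        hexpint (b := ε m * N + ε m ^ 2 * C) ((hfm.const_mul _).add ((hDm m).const_mul _)) (by
          filter_upwards [hfN, hDC m] with x hx hx'
          have := hε0 m
          have := (abs_le.1 hx).2
          have := (abs_le.1 hx').2
          gcongr)
      have h1 := lintegral_exp_mul_le_sq hw hLC hf.continuous (ε m)
      rw [← hν] at h1
      have h2 : ∫⁻ x, expSupConv j f (ε m) x ∂ν ≤
          ∫⁻ x, ENNReal.ofReal (Real.exp (ε m * f x + ε m ^ 2 * D m x)) ∂ν := by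
        refine lintegral_mono_ae ?_
        filter_upwards [hMC m] with x hx
        rw [(hqle m x _ hx).2]
        refine ENNReal.ofReal_le_ofReal (Real.exp_le_exp.2 ?_)
        gcongr
        exact le_max_left _ _
      have h3 := h1.trans (pow_le_pow_left' h2 2)
      rw [← ofReal_integral_eq_lintegral_ofReal hi1 (ae_of_all _ fun x => (Real.exp_pos _).le),
        ← ofReal_integral_eq_lintegral_ofReal hi2 (ae_of_all _ fun x => (Real.exp_pos _).le),
        ← ofReal_measureReal, ← ENNReal.ofReal_mul measureReal_nonneg,
        ← ENNReal.ofReal_pow (integral_nonneg fun x => (Real.exp_pos _).le)] at h3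
      exact (ENNReal.ofReal_le_ofReal_iff (sq_nonneg _)).1 h3
  have hi_f2 : Integrable (fun x => f x ^ 2) ν :=
    Integrable.of_bound (hfm.pow_const 2).aestronglyMeasurable (N ^ 2) (hfN.mono fun x hx => by
      rw [Real.norm_eq_abs, abs_pow]; gcongr)
  have hi_G : Integrable G ν := Integrable.of_bound hGm.aestronglyMeasurable C
    (ae_of_all _ fun x => by rw [Real.norm_of_nonneg (hG0 x)]; exact min_le_right _ _)
  rw [← ofReal_integral_eq_lintegral_ofReal hi_f2 (ae_of_all _ fun x => sq_nonneg _),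
    ← ofReal_measureReal, ← ENNReal.ofReal_mul measureReal_nonneg]
  refine (ENNReal.ofReal_le_ofReal key).trans ?_
  rw [ENNReal.ofReal_add (sq_nonneg _) (mul_nonneg (mul_nonneg zero_le_two measureReal_nonneg)
    (integral_nonneg hG0)), mul_comm (2 : ℝ), mul_assoc, ENNReal.ofReal_mul measureReal_nonneg,
    ← integral_const_mul, ofReal_integral_eq_lintegral_ofReal (hi_G.const_mul 2)
    (ae_of_all _ fun x => mul_nonneg zero_le_two (hG0 x))]
  gcongr
  exact min_le_left _ _

/-- In each coordinate one of the factors `1 ± η i` is at least `1`, so if both outer points lie in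
the box, `z` does too. -/
theorem PowMidLogConcave.indicator_le {j n : ℕ} {w : (Fin n → ℝ) → ℝ≥0∞}
    (h : PowMidLogConcave j w) (R : ℝ) :
    PowMidLogConcave j (Set.indicator {x | ∀ i, x i ≤ R} w) := by
  classical
  intro z η hz hη
  by_cases hx : (fun i => z i * (1 + η i) ^ (j + 1)) ∈ {x : Fin n → ℝ | ∀ i, x i ≤ R}
  swap
  · rw [Set.indicator_of_notMem hx]; simp
  by_cases hy : (fun i => z i * (1 - η i) ^ (j + 1)) ∈ {x : Fin n → ℝ | ∀ i, x i ≤ R}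
  swap
  · rw [Set.indicator_of_notMem hy]; simp
  have hzmem : z ∈ {x : Fin n → ℝ | ∀ i, x i ≤ R} := fun i => by
    rcases le_total 0 (η i) with h0 | h0
    · exact (le_mul_of_one_le_right (hz i).le (one_le_pow₀ (by linarith))).trans (hx i)
    · exact (le_mul_of_one_le_right (hz i).le (one_le_pow₀ (by linarith))).trans (hy i)
  rw [Set.indicator_of_mem hx, Set.indicator_of_mem hy, Set.indicator_of_mem hzmem]
  exact h z η hz hη

open Filter Topology in
/-- The weighted Poincaré inequality on the orthant. -/
theorem variance_le_posOrthant {j n : ℕ} (hj : 0 < j) {w : (Fin n → ℝ) → ℝ≥0∞}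
    (hw : AEMeasurable w (volume.restrict (posOrthant n))) (hLC : PowMidLogConcave j w)
    {ν : Measure (Fin n → ℝ)} (hν : ν = (volume.restrict (posOrthant n)).withDensity w)
    [IsFiniteMeasure ν] {f : (Fin n → ℝ) → ℝ} (hf : LocallyLipschitz f) (hfi : Integrable f ν) :
    ν Set.univ * ∫⁻ x, ENNReal.ofReal (f x ^ 2) ∂ν ≤
      ENNReal.ofReal ((∫ x, f x ∂ν) ^ 2) +
        ν Set.univ * ∫⁻ x, ENNReal.ofReal (2 * weightedGradSq j f x) ∂ν := by
  rcases eq_or_ne ν 0 with h0 | h0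
  · simp [h0]
  set K : ℕ → Set (Fin n → ℝ) := fun N => {x | ∀ i, x i ≤ N} with hK
  have hKm : ∀ N, MeasurableSet (K N) := fun N => by
    have : K N = Set.univ.pi fun _ => Set.Iic (N : ℝ) := by ext x; simp [hK, Pi.le_def]
    rw [this]
    exact MeasurableSet.univ_pi fun _ => measurableSet_Iic
  have hKmono : Monotone K := fun N M hNM x hx i => (hx i).trans (by exact_mod_cast hNM)
  have hKU : ⋃ N, K N = Set.univ := by
    refine Set.eq_univ_of_forall fun x => Set.mem_iUnion.2 ?_
    obtain ⟨N, hN⟩ := exists_nat_ge (∑ i, |x i|)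
    exact ⟨N, fun i => (le_abs_self _).trans ((Finset.single_le_sum (f := fun i => |x i|)
      (fun i _ => abs_nonneg _) (Finset.mem_univ i)).trans hN)⟩
  have hstep : ∀ N, ν (K N) * ∫⁻ x in K N, ENNReal.ofReal (f x ^ 2) ∂ν ≤
      ENNReal.ofReal ((∫ x in K N, f x ∂ν) ^ 2) +
        ν Set.univ * ∫⁻ x, ENNReal.ofReal (2 * weightedGradSq j f x) ∂ν := by
    intro N
    have hνN : ν.restrict (K N) =
        (volume.restrict (posOrthant n)).withDensity ((K N).indicator w) := by
      rw [hν, restrict_withDensity (hKm N), withDensity_indicator (hKm N)]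
    have h1 := variance_le_of_support_subset hj (hw.indicator (hKm N)) (hLC.indicator_le N) hνN
      (R := N) (fun x hx => Set.mem_of_indicator_ne_zero hx) hf
    rw [Measure.restrict_apply_univ] at h1
    refine h1.trans ?_
    gcongr
    · exact Set.subset_univ _
    · exact Measure.restrict_le_self
  have hlim1 : Tendsto (fun N => ν (K N)) atTop (𝓝 (ν Set.univ)) := by
    rw [← hKU]; exact tendsto_measure_iUnion_atTop hKmono
  have hlim2 : Tendsto (fun N => ∫⁻ x in K N, ENNReal.ofReal (f x ^ 2) ∂ν) atTop
      (𝓝 (∫⁻ x, ENNReal.ofReal (f x ^ 2) ∂ν)) := by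
    have hmeas : Measurable fun x => ENNReal.ofReal (f x ^ 2) :=
      (hf.continuous.measurable.pow_const 2).ennreal_ofReal
    have := tendsto_measure_iUnion_atTop
      (μ := ν.withDensity fun x => ENNReal.ofReal (f x ^ 2)) hKmono
    rw [hKU] at this
    simpa only [Function.comp_def, withDensity_apply _ (hKm _), withDensity_apply _ MeasurableSet.univ,
      Measure.restrict_univ] using this
  have hlim3 : Tendsto (fun N => ∫ x in K N, f x ∂ν) atTop (𝓝 (∫ x, f x ∂ν)) := by
    have := tendsto_setIntegral_of_monotone (μ := ν) (f := f) hKm hKmono hfi.integrableOn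
    rwa [hKU, setIntegral_univ] at this
  -- The integral of `f ^ 2` may be infinite, so passing to the limit in the product needs `ν`
  -- nonzero and finite.
  refine le_of_tendsto_of_tendsto' (ENNReal.Tendsto.mul hlim1 (Or.inl ?_) hlim2 (Or.inr ?_))
    (((ENNReal.tendsto_ofReal (hlim3.pow 2))).add_const _) hstep
  · simpa using h0
  · exact measure_ne_top _ _

/-! ### Sign changes and the decomposition into orthants -/

/-- The reflection of `ℝⁿ` that changes the signs of the coordinates marked by `σ`. -/
def signFlip {n : ℕ} (σ : Fin n → Bool) (x : Fin n → ℝ) : Fin n → ℝ :=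
  fun i => if σ i then -x i else x i

theorem signFlip_apply {n : ℕ} (σ : Fin n → Bool) (x : Fin n → ℝ) (i : Fin n) :
    signFlip σ x i = if σ i then -x i else x i := rfl

theorem abs_signFlip {n : ℕ} (σ : Fin n → Bool) (x : Fin n → ℝ) (i : Fin n) :
    |signFlip σ x i| = |x i| := by
  rw [signFlip_apply]; split_ifs <;> simp

theorem signFlip_sq {n : ℕ} (σ : Fin n → Bool) (x : Fin n → ℝ) (i : Fin n) :
    signFlip σ x i ^ 2 = x i ^ 2 := by
  rw [← sq_abs, abs_signFlip, sq_abs]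

theorem signFlip_involutive {n : ℕ} (σ : Fin n → Bool) : Function.Involutive (signFlip σ) := by
  intro x; ext i
  simp only [signFlip_apply]
  split_ifs <;> simp

theorem signFlip_signFlip {n : ℕ} (σ : Fin n → Bool) (x : Fin n → ℝ) :
    signFlip σ (signFlip σ x) = x :=
  signFlip_involutive σ x

theorem lipschitzWith_signFlip {n : ℕ} (σ : Fin n → Bool) : LipschitzWith 1 (signFlip σ) := by
  refine LipschitzWith.of_dist_le_mul fun x y => ?_
  rw [NNReal.coe_one, one_mul]
  refine (dist_pi_le_iff dist_nonneg).2 fun i => le_trans (le_of_eq ?_) (dist_le_pi_dist x y i)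
  simp only [signFlip_apply]
  split_ifs
  · rw [dist_neg_neg]
  · rfl

theorem measurableEmbedding_signFlip {n : ℕ} (σ : Fin n → Bool) :
    MeasurableEmbedding (signFlip σ) :=
  (MeasurableEquiv.ofInvolutive _ (signFlip_involutive σ)
    (lipschitzWith_signFlip σ).continuous.measurable).measurableEmbedding

theorem volume_preserving_signFlip {n : ℕ} (σ : Fin n → Bool) :
    MeasurePreserving (signFlip σ) volume volume := by
  have : signFlip σ = fun x i => (fun t : ℝ => if σ i then -t else t) (x i) := rfl
  rw [this]
  refine volume_preserving_pi (f := fun i (t : ℝ) => if σ i then -t else t) fun i => ?_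
  cases σ i
  · simpa using! MeasurePreserving.id volume
  · simpa using Measure.measurePreserving_neg (volume : Measure ℝ)

theorem measurePreserving_signFlip_withDensity {n : ℕ} (σ : Fin n → Bool)
    {w : (Fin n → ℝ) → ℝ≥0∞} (hw : Unconditional w) :
    MeasurePreserving (signFlip σ) (volume.withDensity w) (volume.withDensity w) := by
  refine ⟨(lipschitzWith_signFlip σ).continuous.measurable, Measure.ext fun s hs => ?_⟩
  have hms : MeasurableSet (signFlip σ ⁻¹' s) :=
    (lipschitzWith_signFlip σ).continuous.measurable hs
  rw [(measurableEmbedding_signFlip σ).map_apply, withDensity_apply _ hms, withDensity_apply _ hs,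
    ← (volume_preserving_signFlip σ).setLIntegral_comp_preimage_emb
      (measurableEmbedding_signFlip σ) w s]
  refine lintegral_congr fun x => ?_
  rw [hw x, hw (signFlip σ x)]
  congr 1
  ext i
  exact (abs_signFlip σ x i).symm

theorem iUnion_signFlip_preimage_ae {n : ℕ} {μ : Measure (Fin n → ℝ)} (hμ : μ ≪ volume) :
    (⋃ σ : Fin n → Bool, signFlip σ ⁻¹' posOrthant n) =ᵐ[μ] Set.univ := by
  rw [ae_eq_univ]
  refine hμ (measure_mono_null (t := ⋃ i, {x : Fin n → ℝ | x i = 0}) ?_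
    (measure_iUnion_null fun i => by rw [volume_pi]; exact Measure.pi_hyperplane _ i 0))
  intro x hx
  by_contra hne
  simp only [Set.mem_iUnion, not_exists, Set.mem_ofPred_eq] at hne
  refine hx (Set.mem_iUnion.2 ⟨fun i => decide (x i < 0), fun i => ?_⟩)
  rw [signFlip_apply]
  by_cases h : x i < 0
  · simp [h]
  · simpa [h] using lt_of_le_of_ne (not_lt.1 h) (Ne.symm (hne i))

theorem pairwise_disjoint_signFlip_preimage (n : ℕ) :
    Pairwise (Function.onFun Disjoint fun σ : Fin n → Bool => signFlip σ ⁻¹' posOrthant n) := by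
  intro σ τ hne
  refine Set.disjoint_left.2 fun x hx hy => hne (funext fun i => ?_)
  have h1 := hx i
  have h2 := hy i
  rw [signFlip_apply] at h1 h2
  cases h3 : σ i <;> cases h4 : τ i <;> simp [h3, h4] at h1 h2 ⊢ <;> linarith

theorem measurableSet_signFlip_preimage {n : ℕ} (σ : Fin n → Bool) :
    MeasurableSet (signFlip σ ⁻¹' posOrthant n) :=
  (lipschitzWith_signFlip σ).continuous.measurable (measurableSet_posOrthant n)

/-- The reflected orthants are disjoint and cover everything but the coordinate hyperplanes, which
are null; invariance of `μ` moves each piece back to the positive orthant. -/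
theorem lintegral_eq_sum_signFlip {n : ℕ} {μ : Measure (Fin n → ℝ)} (hμ : μ ≪ volume)
    (hσ : ∀ σ, MeasurePreserving (signFlip σ) μ μ) (F : (Fin n → ℝ) → ℝ≥0∞) :
    ∫⁻ x, F x ∂μ = ∑ σ : Fin n → Bool, ∫⁻ x in posOrthant n, F (signFlip σ x) ∂μ := by
  rw [← setLIntegral_univ, ← setLIntegral_congr (iUnion_signFlip_preimage_ae hμ),
    lintegral_iUnion measurableSet_signFlip_preimage (pairwise_disjoint_signFlip_preimage n),
    tsum_fintype]
  refine Finset.sum_congr rfl fun σ _ => ?_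
  have := (hσ σ).setLIntegral_comp_preimage_emb (measurableEmbedding_signFlip σ)
    (fun x => F (signFlip σ x)) (posOrthant n)
  simpa only [signFlip_signFlip] using this

theorem integral_eq_sum_signFlip {n : ℕ} {μ : Measure (Fin n → ℝ)} (hμ : μ ≪ volume)
    (hσ : ∀ σ, MeasurePreserving (signFlip σ) μ μ) {F : (Fin n → ℝ) → ℝ} (hF : Integrable F μ) :
    ∫ x, F x ∂μ = ∑ σ : Fin n → Bool, ∫ x in posOrthant n, F (signFlip σ x) ∂μ := by
  rw [← setIntegral_univ, ← setIntegral_congr_set (iUnion_signFlip_preimage_ae hμ),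
    integral_iUnion_fintype measurableSet_signFlip_preimage (pairwise_disjoint_signFlip_preimage n)
      fun σ => hF.integrableOn]
  refine Finset.sum_congr rfl fun σ _ => ?_
  have := (hσ σ).setIntegral_preimage_emb (measurableEmbedding_signFlip σ)
    (fun x => F (signFlip σ x)) (posOrthant n)
  simpa only [signFlip_signFlip] using this

/-! ### Variance on the discrete cube -/

/-- The Poincaré inequality on the discrete cube. -/
theorem sum_sq_le_cube : ∀ (n : ℕ) (a : (Fin n → Bool) → ℝ),
    2 ^ n * ∑ σ, a σ ^ 2 ≤ (∑ σ, a σ) ^ 2 +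
      2 ^ n * (1 / 4 * ∑ σ, ∑ i, (a σ - a (Function.update σ i (!σ i))) ^ 2)
  | 0, a => by
    simp
  | n + 1, a => by
    have hsplit : ∀ F : (Fin (n + 1) → Bool) → ℝ,
        ∑ σ, F σ = ∑ τ, F (Fin.cons false τ) + ∑ τ, F (Fin.cons true τ) := by
      intro F
      rw [← (Fin.consEquiv fun _ : Fin (n + 1) => Bool).sum_comp, Fintype.sum_prod_type,
        Fintype.sum_bool, add_comm]
      rfl
    have h0 := sum_sq_le_cube n fun τ => a (Fin.cons false τ)
    have h1 := sum_sq_le_cube n fun τ => a (Fin.cons true τ)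
    simp only [hsplit, Fin.sum_univ_succ, Fin.cons_zero, Fin.cons_succ, Fin.update_cons_zero,
      ← Fin.cons_update, Bool.not_false, Bool.not_true, Finset.sum_add_distrib]
    set A0 := ∑ τ, a (Fin.cons false τ)
    set A1 := ∑ τ, a (Fin.cons true τ)
    -- The two halves give `2 (A0² + A1²) = (A0 + A1)² + (A0 - A1)²`. The last square is paid for
    -- exactly by the differences in the new coordinate: each edge is counted from both ends, and `2
    -- ^ (n + 1) * (1 / 4) * 2 = 2 ^ n`.
    have hcs : (A0 - A1) ^ 2 ≤
        2 ^ n * ∑ τ, (a (Fin.cons false τ) - a (Fin.cons true τ)) ^ 2 := by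
      rw [← Finset.sum_sub_distrib]
      have := sq_sum_le_card_mul_sum_sq (s := Finset.univ)
        (f := fun τ : Fin n → Bool => a (Fin.cons false τ) - a (Fin.cons true τ))
      simpa using this
    have hsymm : ∑ τ : Fin n → Bool, (a (Fin.cons true τ) - a (Fin.cons false τ)) ^ 2 =
        ∑ τ : Fin n → Bool, (a (Fin.cons false τ) - a (Fin.cons true τ)) ^ 2 :=
      Finset.sum_congr rfl fun τ _ => by ring
    rw [hsymm, pow_succ]
    nlinarith

/-! ### Variation along a coordinate, and derivatives of reflected functions -/

theorem lipschitzWith_update {n : ℕ} (x : Fin n → ℝ) (i : Fin n) :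
    LipschitzWith 1 fun t : ℝ => Function.update x i t := by
  refine LipschitzWith.of_dist_le_mul fun s t => ?_
  rw [NNReal.coe_one, one_mul]
  refine (dist_pi_le_iff dist_nonneg).2 fun k => ?_
  rcases eq_or_ne k i with rfl | h
  · simp
  · simp [Function.update_of_ne h, dist_nonneg]

theorem deriv_comp_update {n : ℕ} (f : (Fin n → ℝ) → ℝ) (x : Fin n → ℝ) (i : Fin n) (t : ℝ) :
    deriv (fun s => f (Function.update x i s)) t = partialDeriv i f (Function.update x i t) := by
  have h : (fun s : ℝ => f (Function.update x i t + s • Pi.single i 1)) =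
      fun s => (fun s => f (Function.update x i s)) (t + s) := by
    funext s
    congr 1
    ext k
    rcases eq_or_ne k i with rfl | h
    · simp
    · simp [Function.update_of_ne h, Pi.single_eq_of_ne h]
  rw [partialDeriv, lineDeriv, h,
    deriv_comp_const_add (f := fun s => f (Function.update x i s)) t 0, add_zero]

/-- A locally Lipschitz function changes along a coordinate by at most the integral of the
absolute value of the partial derivative. -/
theorem LocallyLipschitz.enorm_sub_update_le {n : ℕ} {f : (Fin n → ℝ) → ℝ}
    (hf : LocallyLipschitz f) (x : Fin n → ℝ) {i : Fin n} (hx : 0 < x i) :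
    ‖f x - f (Function.update x i 0)‖ₑ ≤
      ∫⁻ t in Set.Ioc 0 (x i), ‖partialDeriv i f (Function.update x i t)‖ₑ := by
  have hlip : LocallyLipschitz fun t => f (Function.update x i t) :=
    hf.comp (lipschitzWith_update x i).locallyLipschitz
  obtain ⟨K, hK⟩ := LocallyLipschitzOn.exists_lipschitzOnWith_of_compact
    (isCompact_uIcc (a := 0) (b := x i)) hlip.locallyLipschitzOn
  have h1 := hK.absolutelyContinuousOnInterval.integral_deriv_eq_sub
  simp only [Function.update_eq_self] at h1
  rw [← h1, intervalIntegral.integral_of_le hx.le]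
  refine (enorm_integral_le_lintegral_enorm _).trans (le_of_eq ?_)
  simp only [deriv_comp_update]

theorem partialDeriv_comp_signFlip {n : ℕ} (f : (Fin n → ℝ) → ℝ) (σ : Fin n → Bool) (i : Fin n)
    (x : Fin n → ℝ) :
    partialDeriv i (fun y => f (signFlip σ y)) x =
      (if σ i then -1 else 1) * partialDeriv i f (signFlip σ x) := by
  have h : (fun s : ℝ => f (signFlip σ (x + s • Pi.single i 1))) =
      fun s => (fun s : ℝ => f (signFlip σ x + s • Pi.single i 1)) ((if σ i then -1 else 1) * s) := by
    funext s
    congr 1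
    ext k
    simp only [signFlip_apply, Pi.add_apply, Pi.smul_apply, smul_eq_mul]
    rcases eq_or_ne k i with rfl | h
    · split_ifs
      · simp; ring
      · simp
    · simp [Pi.single_eq_of_ne h]
  rw [partialDeriv, lineDeriv, h]
  refine (deriv_comp_mul_left _ (fun s : ℝ => f (signFlip σ x + s • Pi.single i 1)) 0).trans ?_
  rw [mul_zero, smul_eq_mul]
  rfl

/-! ### Hardy-type inequalities for decreasing densities -/

theorem ENNReal.lintegral_mul_sq_le {X : Type*} [MeasurableSpace X] (μ : Measure X)
    {f g : X → ℝ≥0∞} (hf : AEMeasurable f μ) (hg : AEMeasurable g μ) :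
    (∫⁻ x, f x * g x ∂μ) ^ 2 ≤ (∫⁻ x, f x ^ 2 ∂μ) * ∫⁻ x, g x ^ 2 ∂μ := by
  have h := ENNReal.lintegral_mul_le_Lp_mul_Lq μ Real.HolderConjugate.two_two hf hg
  have h2 : ∀ a : ℝ≥0∞, (a ^ (1 / 2 : ℝ)) ^ 2 = a := fun a => by
    rw [← ENNReal.rpow_natCast, ← ENNReal.rpow_mul]; norm_num
  calc (∫⁻ x, f x * g x ∂μ) ^ 2 ≤ _ := pow_le_pow_left' h 2
    _ = _ := by
      rw [mul_pow, h2, h2]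
      simp only [ENNReal.rpow_two]

/-- Cauchy–Schwarz for a function dominated by a geometric mean. -/
theorem ENNReal.lintegral_sq_le_of_sq_le_mul {X : Type*} [MeasurableSpace X] (μ : Measure X)
    {H A B : X → ℝ≥0∞} (hA : AEMeasurable A μ) (hB : AEMeasurable B μ)
    (h : ∀ᵐ x ∂μ, H x ^ 2 ≤ A x * B x) :
    (∫⁻ x, H x ∂μ) ^ 2 ≤ (∫⁻ x, A x ∂μ) * ∫⁻ x, B x ∂μ := by
  have h2 : ∀ a : ℝ≥0∞, (a ^ (1 / 2 : ℝ)) ^ 2 = a := fun a => by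
    rw [← ENNReal.rpow_natCast, ← ENNReal.rpow_mul]; norm_num
  have h1 : ∫⁻ x, H x ∂μ ≤ ∫⁻ x, A x ^ (1 / 2 : ℝ) * B x ^ (1 / 2 : ℝ) ∂μ := by
    refine lintegral_mono_ae (h.mono fun x hx => ?_)
    rw [← ENNReal.mul_rpow_of_nonneg _ _ (by norm_num : (0 : ℝ) ≤ 1 / 2)]
    have h3 : (H x ^ 2) ^ (1 / 2 : ℝ) = H x := by
      rw [← ENNReal.rpow_natCast, ← ENNReal.rpow_mul]; norm_num
    rw [← h3]
    exact ENNReal.rpow_le_rpow hx (by norm_num)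
  calc (∫⁻ x, H x ∂μ) ^ 2 ≤ _ := pow_le_pow_left' h1 2
    _ ≤ _ := ENNReal.lintegral_mul_sq_le μ (hA.pow_const _) (hB.pow_const _)
    _ = _ := by simp only [h2]

theorem measurable_lintegral_of_uncurry {F : ℝ → ℝ → ℝ≥0∞}
    (hF : Measurable (Function.uncurry F)) (ν : Measure ℝ) [SFinite ν] :
    Measurable fun t => ∫⁻ x, F t x ∂ν :=
  Measurable.lintegral_prod_right' hF

/-- The square is a double integral, twice the part with `y ≤ x` at most. There `ρ y ≤ ρ t`, and `y`
runs over an interval of length `x - t`. The right side is arranged so that its second factor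
integrates over `t` to the second moment. -/
theorem tail_sq_le {ρ : ℝ → ℝ≥0∞} (hρ : Antitone ρ) (t : ℝ) :
    (∫⁻ x in Set.Ici t, ρ x) ^ 2 ≤
      ρ t * ∫⁻ x in Set.Ici t, 2 * (ENNReal.ofReal (x - t) * ρ x) := by
  have hρm := hρ.measurable
  set ν := (volume : Measure ℝ).restrict (Set.Ici t) with hν
  have hle : MeasurableSet {p : ℝ × ℝ | p.2 ≤ p.1} := measurableSet_le measurable_snd measurable_fst
  set F : ℝ → ℝ → ℝ≥0∞ := fun x y =>
    Set.indicator {p : ℝ × ℝ | p.2 ≤ p.1} (fun p => ρ p.1 * ρ p.2) (x, y) with hF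
  have hFm : Measurable (Function.uncurry F) :=
    ((hρm.comp measurable_fst).mul (hρm.comp measurable_snd)).indicator hle
  have hone : ∫⁻ x, ∫⁻ y, F x y ∂ν ∂ν ≤
      ρ t * ∫⁻ x, ENNReal.ofReal (x - t) * ρ x ∂ν := by
    rw [← lintegral_const_mul _ (by fun_prop)]
    refine lintegral_mono fun x => ?_
    calc ∫⁻ y, F x y ∂ν ≤ ∫⁻ y, (Set.Icc t x).indicator (fun _ => ρ x * ρ t) y := by
          rw [hν, ← lintegral_indicator measurableSet_Ici]
          refine lintegral_mono fun y => ?_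
          by_cases h1 : y ∈ Set.Ici t
          · rw [Set.indicator_of_mem h1]
            simp only [hF]
            by_cases h2 : y ≤ x
            · rw [Set.indicator_of_mem (show (x, y) ∈ {p : ℝ × ℝ | p.2 ≤ p.1} from h2),
                Set.indicator_of_mem (show y ∈ Set.Icc t x from ⟨h1, h2⟩)]
              exact mul_le_mul' le_rfl (hρ h1)
            · rw [Set.indicator_of_notMem (show (x, y) ∉ {p : ℝ × ℝ | p.2 ≤ p.1} from h2)]
              exact bot_le
          · rw [Set.indicator_of_notMem h1]
            exact bot_le
      _ = ρ t * (ENNReal.ofReal (x - t) * ρ x) := by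
          rw [lintegral_indicator measurableSet_Icc, setLIntegral_const, Real.volume_Icc]
          ring
  calc (∫⁻ x, ρ x ∂ν) ^ 2 = ∫⁻ x, ∫⁻ y, ρ x * ρ y ∂ν ∂ν := by
        rw [sq, ← lintegral_mul_const _ hρm]
        exact lintegral_congr fun x => (lintegral_const_mul _ hρm).symm
    _ ≤ ∫⁻ x, ∫⁻ y, (F x y + F y x) ∂ν ∂ν := by
        refine lintegral_mono fun x => lintegral_mono fun y => ?_
        simp only [hF]
        rcases le_total y x with h | h
        · rw [Set.indicator_of_mem (show (x, y) ∈ {p : ℝ × ℝ | p.2 ≤ p.1} from h)]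
          exact le_self_add
        · rw [Set.indicator_of_mem (show (y, x) ∈ {p : ℝ × ℝ | p.2 ≤ p.1} from h), mul_comm (ρ x)]
          exact le_add_self
    _ = ∫⁻ x, ∫⁻ y, F x y ∂ν ∂ν + ∫⁻ x, ∫⁻ y, F y x ∂ν ∂ν := by
        rw [← lintegral_add_left (measurable_lintegral_of_uncurry hFm ν)]
        exact lintegral_congr fun x => lintegral_add_left (hFm.comp measurable_prodMk_left) _
    _ = 2 * ∫⁻ x, ∫⁻ y, F x y ∂ν ∂ν := by
        rw [lintegral_lintegral_swap (f := fun x y => F y x)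
          (hFm.comp measurable_swap).aemeasurable, two_mul]
    _ ≤ 2 * (ρ t * ∫⁻ x, ENNReal.ofReal (x - t) * ρ x ∂ν) := by gcongr
    _ = _ := by
        rw [lintegral_const_mul _ (by fun_prop)]
        ring

/-- The order of integration over `0 < t ≤ x`. -/
theorem lintegral_triangle_swap {F : ℝ → ℝ → ℝ≥0∞} (hF : Measurable (Function.uncurry F)) :
    ∫⁻ x in Set.Ioi 0, ∫⁻ t in Set.Ioc 0 x, F x t =
      ∫⁻ t in Set.Ioi 0, ∫⁻ x in Set.Ici t, F x t := by
  have hle : MeasurableSet {p : ℝ × ℝ | 0 < p.2 ∧ p.2 ≤ p.1} :=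
    (measurableSet_lt measurable_const measurable_snd).inter
      (measurableSet_le measurable_snd measurable_fst)
  set T := {p : ℝ × ℝ | 0 < p.2 ∧ p.2 ≤ p.1}
  have hG : Measurable (T.indicator (Function.uncurry F)) := hF.indicator hle
  calc _ = ∫⁻ x, ∫⁻ t, T.indicator (Function.uncurry F) (x, t) := by
        rw [← lintegral_indicator measurableSet_Ioi]
        refine lintegral_congr fun x => ?_
        by_cases hx : x ∈ Set.Ioi (0 : ℝ)
        · rw [Set.indicator_of_mem hx, ← lintegral_indicator measurableSet_Ioc]
          refine lintegral_congr fun t => ?_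
          by_cases ht : t ∈ Set.Ioc 0 x
          · rw [Set.indicator_of_mem ht, Set.indicator_of_mem (show (x, t) ∈ T from ht)]
            rfl
          · rw [Set.indicator_of_notMem ht, Set.indicator_of_notMem (show (x, t) ∉ T from ht)]
        · rw [Set.indicator_of_notMem hx]
          refine (lintegral_eq_zero_of_ae_eq_zero (ae_of_all _ fun t => ?_)).symm
          exact Set.indicator_of_notMem (fun h : (x, t) ∈ T => hx (h.1.trans_le h.2)) _
    _ = ∫⁻ t, ∫⁻ x, T.indicator (Function.uncurry F) (x, t) :=
        lintegral_lintegral_swap (f := fun x t => T.indicator (Function.uncurry F) (x, t))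
          hG.aemeasurable
    _ = _ := by
        rw [← lintegral_indicator measurableSet_Ioi]
        refine lintegral_congr fun t => ?_
        by_cases ht : t ∈ Set.Ioi (0 : ℝ)
        · rw [Set.indicator_of_mem ht, ← lintegral_indicator measurableSet_Ici]
          refine lintegral_congr fun x => ?_
          by_cases hx : x ∈ Set.Ici t
          · rw [Set.indicator_of_mem hx, Set.indicator_of_mem (show (x, t) ∈ T from ⟨ht, hx⟩)]
            rfl
          · rw [Set.indicator_of_notMem hx,
              Set.indicator_of_notMem (fun h : (x, t) ∈ T => hx h.2)]
        · rw [Set.indicator_of_notMem ht]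
          refine lintegral_eq_zero_of_ae_eq_zero (ae_of_all _ fun x => ?_)
          exact Set.indicator_of_notMem (fun h : (x, t) ∈ T => ht h.1) _

theorem lintegral_two_mul_sub {x : ℝ} (hx : 0 < x) :
    ∫⁻ t in Set.Ioc 0 x, 2 * ENNReal.ofReal (x - t) = ENNReal.ofReal (x ^ 2) := by
  have h1 : ∀ t, 2 * ENNReal.ofReal (x - t) = ENNReal.ofReal (2 * (x - t)) := fun t => by
    rw [ENNReal.ofReal_mul zero_le_two, ENNReal.ofReal_ofNat]
  simp only [h1]
  rw [← ofReal_integral_eq_lintegral_ofReal, ← intervalIntegral.integral_of_le hx.le]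
  · congr 1
    rw [intervalIntegral.integral_const_mul, intervalIntegral.integral_sub (by simp) (by simp),
      integral_id]
    simp
    ring
  · exact (by fun_prop : Continuous fun t : ℝ => 2 * (x - t)).integrableOn_Ioc
  · filter_upwards [ae_restrict_mem measurableSet_Ioc] with t ht
    have := ht.2
    simp only [Pi.zero_apply]
    linarith

/-- A weighted Hardy-type inequality on the half-line for a decreasing density. -/
theorem hardy_Ioi {ρ g : ℝ → ℝ≥0∞} (hρ : AntitoneOn ρ (Set.Ioi 0)) (hg : Measurable g) :
    (∫⁻ x in Set.Ioi 0, (∫⁻ t in Set.Ioc 0 x, g t) * ρ x) ^ 2 ≤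
      (∫⁻ x in Set.Ioi 0, g x ^ 2 * ρ x) * ∫⁻ x in Set.Ioi 0, ENNReal.ofReal (x ^ 2) * ρ x := by
  wlog hρ' : Antitone ρ generalizing ρ
  -- The value `∞` on the nonpositive axis extends `ρ` to a function decreasing on the whole line,
  -- hence measurable.
  · set ρ' : ℝ → ℝ≥0∞ := fun x => if x ≤ 0 then ∞ else ρ x with hρ'def
    have heq : ∀ x ∈ Set.Ioi (0 : ℝ), ρ' x = ρ x := fun x hx => if_neg (not_le.2 hx)
    have hanti : Antitone ρ' := by
      intro x y hxy
      by_cases h1 : x ≤ 0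
      · simp only [hρ'def, if_pos h1, le_top]
      · have hx : 0 < x := not_le.1 h1
        rw [heq x hx, heq y (hx.trans_le hxy)]
        exact hρ hx (hx.trans_le hxy) hxy
    have hcongr : ∀ H : ℝ → ℝ≥0∞,
        ∫⁻ x in Set.Ioi 0, H x * ρ' x = ∫⁻ x in Set.Ioi 0, H x * ρ x := fun H =>
      setLIntegral_congr_fun measurableSet_Ioi fun x hx => by simp only [heq x hx]
    have := this (hanti.antitoneOn _) hanti
    simpa only [hcongr] using this
  have hρm := hρ'.measurable
  have h1 : ∫⁻ x in Set.Ioi 0, (∫⁻ t in Set.Ioc 0 x, g t) * ρ x =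
      ∫⁻ t in Set.Ioi 0, g t * ∫⁻ x in Set.Ici t, ρ x := by
    calc _ = ∫⁻ x in Set.Ioi 0, ∫⁻ t in Set.Ioc 0 x, g t * ρ x :=
          lintegral_congr fun x => (lintegral_mul_const _ hg).symm
      _ = ∫⁻ t in Set.Ioi 0, ∫⁻ x in Set.Ici t, g t * ρ x :=
          lintegral_triangle_swap (F := fun x t => g t * ρ x)
            ((hg.comp measurable_snd).mul (hρm.comp measurable_fst))
      _ = _ := lintegral_congr fun t => lintegral_const_mul _ hρm
  have hFm : Measurable (Function.uncurry fun x t : ℝ => 2 * (ENNReal.ofReal (x - t) * ρ x)) := by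
    have h2 : Measurable fun p : ℝ × ℝ => ρ p.1 := hρm.comp measurable_fst
    exact ((measurable_fst.sub measurable_snd).ennreal_ofReal.mul h2).const_mul 2
  have h2 : ∫⁻ t in Set.Ioi 0, ∫⁻ x in Set.Ici t, 2 * (ENNReal.ofReal (x - t) * ρ x) =
      ∫⁻ x in Set.Ioi 0, ENNReal.ofReal (x ^ 2) * ρ x := by
    rw [← lintegral_triangle_swap (F := fun x t => 2 * (ENNReal.ofReal (x - t) * ρ x)) hFm]
    refine setLIntegral_congr_fun measurableSet_Ioi fun x hx => ?_
    simp only [← mul_assoc]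
    rw [lintegral_mul_const _ (by fun_prop), lintegral_two_mul_sub hx]
  rw [h1, ← h2]
  -- With `T` the tail integral of `ρ`, the integrand `g T` satisfies `(g T)² ≤ (g² ρ) (T² / ρ)`
  -- heuristically; the tail estimate replaces the second factor, which avoids dividing by `ρ`.
  refine ENNReal.lintegral_sq_le_of_sq_le_mul _ ((hg.pow_const 2).mul hρm).aemeasurable ?_
    (ae_of_all _ fun t => ?_)
  · have hm : Measurable fun p : ℝ × ℝ => Set.indicator {p : ℝ × ℝ | p.1 ≤ p.2}
        (fun p => 2 * (ENNReal.ofReal (p.2 - p.1) * ρ p.2)) p :=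
      (hFm.comp measurable_swap).indicator (measurableSet_le measurable_fst measurable_snd)
    refine Measurable.aemeasurable ?_
    have h3 := Measurable.lintegral_prod_right' (ν := volume) hm
    refine (congrArg Measurable (funext fun t => ?_)).mp h3
    rw [← lintegral_indicator measurableSet_Ici]
    rfl
  · rw [mul_pow, mul_assoc]
    gcongr
    exact tail_sq_le hρ' t

theorem lintegral_pi_eq_lintegral_insertNth_symm {n : ℕ} (ν : Measure ℝ) [SigmaFinite ν]
    (i : Fin (n + 1)) {F : (Fin (n + 1) → ℝ) → ℝ≥0∞}
    (hF : AEMeasurable F (Measure.pi fun _ => ν)) :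
    ∫⁻ x, F x ∂(Measure.pi fun _ => ν) =
      ∫⁻ y, ∫⁻ t, F (i.insertNth t y) ∂ν ∂(Measure.pi fun _ => ν) := by
  have hp := (measurePreserving_piFinSuccAbove (fun _ : Fin (n + 1) => ν) i).symm
  rw [← hp.lintegral_comp_emb (MeasurableEquiv.measurableEmbedding _), lintegral_prod_symm]
  · rfl
  · exact hF.comp_quasiMeasurePreserving hp.quasiMeasurePreserving

theorem aemeasurable_lintegral_insertNth {n : ℕ} (ν : Measure ℝ) [SigmaFinite ν]
    (i : Fin (n + 1)) {F : (Fin (n + 1) → ℝ) → ℝ≥0∞}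
    (hF : AEMeasurable F (Measure.pi fun _ => ν)) :
    AEMeasurable (fun y => ∫⁻ t, F (i.insertNth t y) ∂ν) (Measure.pi fun _ => ν) := by
  have hp := (measurePreserving_piFinSuccAbove (fun _ : Fin (n + 1) => ν) i).symm
  exact (hF.comp_quasiMeasurePreserving hp.quasiMeasurePreserving).lintegral_prod_left'

theorem measurable_lintegral_update {n : ℕ} (i : Fin n) {g : (Fin n → ℝ) → ℝ≥0∞}
    (hg : Measurable g) :
    Measurable fun x : Fin n → ℝ => ∫⁻ t in Set.Ioc 0 (x i), g (Function.update x i t) := by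
  have hupd : Measurable fun p : (Fin n → ℝ) × ℝ => Function.update p.1 i p.2 := by
    refine measurable_pi_iff.2 fun k => ?_
    rcases eq_or_ne k i with rfl | h
    · simpa using measurable_snd
    · simp only [Function.update_of_ne h]
      exact (measurable_pi_apply k).comp measurable_fst
  have hm : Measurable fun p : (Fin n → ℝ) × ℝ =>
      Set.indicator {p : (Fin n → ℝ) × ℝ | 0 < p.2 ∧ p.2 ≤ p.1 i}
      (fun p => g (Function.update p.1 i p.2)) p :=
    (hg.comp hupd).indicator ((measurableSet_lt measurable_const measurable_snd).inter
      (measurableSet_le measurable_snd ((measurable_pi_apply i).comp measurable_fst)))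
  have h3 := Measurable.lintegral_prod_right' (ν := volume) hm
  refine (congrArg Measurable (funext fun x => ?_)).mp h3
  rw [← lintegral_indicator measurableSet_Ioc]
  rfl

/-- A weighted Hardy-type inequality on the orthant, in the direction of one coordinate, for a
density that decreases in this coordinate. -/
theorem hardy_posOrthant {n : ℕ} (i : Fin n) {w g : (Fin n → ℝ) → ℝ≥0∞}
    (hw : AEMeasurable w (volume.restrict (posOrthant n)))
    (hanti : AntitoneOn w (posOrthant n)) (hg : Measurable g) :
    (∫⁻ x in posOrthant n, (∫⁻ t in Set.Ioc 0 (x i), g (Function.update x i t)) * w x) ^ 2 ≤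
      (∫⁻ x in posOrthant n, g x ^ 2 * w x) *
        ∫⁻ x in posOrthant n, ENNReal.ofReal (x i ^ 2) * w x := by
  cases n with
  | zero => exact i.elim0
  | succ n =>
  have hI := measurable_lintegral_update i hg
  rw [restrict_posOrthant] at hw ⊢
  have hpos : ∀ᵐ y ∂(Measure.pi fun _ : Fin n => (volume : Measure ℝ).restrict (Set.Ioi 0)),
      y ∈ posOrthant n := by
    rw [← restrict_posOrthant]
    exact ae_restrict_mem (measurableSet_posOrthant n)
  have hA : AEMeasurable (fun x => g x ^ 2 * w x) (Measure.pi fun _ => volume.restrict (Set.Ioi 0)) :=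
    (hg.pow_const 2).aemeasurable.mul hw
  have hB : AEMeasurable (fun x => ENNReal.ofReal (x i ^ 2) * w x)
      (Measure.pi fun _ => volume.restrict (Set.Ioi 0)) :=
    ((measurable_pi_apply i).pow_const 2).ennreal_ofReal.aemeasurable.mul hw
  have hH : AEMeasurable (fun x => (∫⁻ t in Set.Ioc 0 (x i), g (Function.update x i t)) * w x)
      (Measure.pi fun _ => volume.restrict (Set.Ioi 0)) := hI.aemeasurable.mul hw
  rw [lintegral_pi_eq_lintegral_insertNth_symm _ i hH,
    lintegral_pi_eq_lintegral_insertNth_symm _ i hA,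
    lintegral_pi_eq_lintegral_insertNth_symm _ i hB]
  -- The half-line inequality holds on each slice; Cauchy–Schwarz in the remaining coordinates
  -- combines the slices.
  refine ENNReal.lintegral_sq_le_of_sq_le_mul _ (aemeasurable_lintegral_insertNth _ i hA)
    (aemeasurable_lintegral_insertNth _ i hB) (hpos.mono fun y hy => ?_)
  have hmem : ∀ t ∈ Set.Ioi (0 : ℝ), i.insertNth t y ∈ posOrthant (n + 1) := fun t ht =>
    i.forall_iff_succAbove.2 ⟨by simpa using ht, fun k => by simpa using hy k⟩
  have hins : Measurable fun t : ℝ => (i.insertNth t y : Fin (n + 1) → ℝ) :=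
    (MeasurableEquiv.piFinSuccAbove (fun _ : Fin (n + 1) => ℝ) i).symm.measurable.comp
      measurable_prodMk_right
  have key := hardy_Ioi (ρ := fun t => w (i.insertNth t y)) (g := fun t => g (i.insertNth t y))
    (fun s hs t ht hst => hanti (hmem s hs) (hmem t ht)
      (i.forall_iff_succAbove.2 ⟨by simpa using hst, fun k => by simp⟩))
    (hg.comp hins)
  simpa only [Fin.insertNth_apply_same, Fin.update_insertNth, Pi.mul_apply] using key

/-! ### From the potential to the density, and assembly over the orthants -/

theorem EReal.exp_neg_mul_exp_neg_le_sq {X Y Z : EReal} (hX : X ≠ ⊥) (hY : Y ≠ ⊥) (hZ : Z ≠ ⊥)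
    (h : Z ≤ ((1 / 2 : ℝ) : EReal) * X + ((1 / 2 : ℝ) : EReal) * Y) :
    EReal.exp (-X) * EReal.exp (-Y) ≤ EReal.exp (-Z) ^ 2 := by
  induction X with
  | bot => exact absurd rfl hX
  | top => simp
  | coe a =>
    induction Y with
    | bot => exact absurd rfl hY
    | top => simp
    | coe b =>
      rw [← EReal.coe_mul, ← EReal.coe_mul, ← EReal.coe_add] at h
      induction Z with
      | bot => exact absurd rfl hZ
      | top => exact absurd (top_le_iff.1 h) (EReal.coe_ne_top _)
      | coe d =>
        rw [EReal.coe_le_coe_iff] at h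
        simp only [← EReal.coe_neg, EReal.exp_coe]
        rw [← ENNReal.ofReal_mul (Real.exp_pos _).le, ← ENNReal.ofReal_pow (Real.exp_pos _).le,
          ← Real.exp_add, ← Real.exp_nat_mul]
        refine ENNReal.ofReal_le_ofReal (Real.exp_le_exp.2 ?_)
        push_cast
        linarith

/-- With `c = z ^ (1 / (j + 1))`, the points `c (1 ± η)` have midpoint `c`, so this is convexity of
`φ (y ^ (j + 1))` with weights `1 / 2`. -/
theorem powMidLogConcave_exp_neg {j n : ℕ} {φ : (Fin n → ℝ) → EReal} (hbot : ∀ x, φ x ≠ ⊥)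
    (hφ : FracConvexOnOrthant (1 / ((j + 1 : ℕ) : ℝ)) φ) :
    PowMidLogConcave j fun x => EReal.exp (-φ x) := by
  intro z η hz hη
  set c : Fin n → ℝ := fun i => z i ^ ((j + 1 : ℕ) : ℝ)⁻¹ with hc
  have hcpos : ∀ i, 0 < c i := fun i => Real.rpow_pos_of_pos (hz i) _
  have hcpow : ∀ i, c i ^ (j + 1) = z i := fun i =>
    Real.rpow_inv_natCast_pow (hz i).le (Nat.succ_ne_zero j)
  have h1 : (fun i => c i * (1 + η i)) ∈ posOrthant n := fun i =>
    mul_pos (hcpos i) (by linarith [(abs_lt.1 (hη i)).1])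
  have h2 : (fun i => c i * (1 - η i)) ∈ posOrthant n := fun i =>
    mul_pos (hcpos i) (by linarith [(abs_lt.1 (hη i)).2])
  have key := hφ.2 _ h1 _ h2 (1 / 2) (1 / 2) (by norm_num) (by norm_num) (by norm_num)
  simp only [one_div_one_div, Real.rpow_natCast, Pi.add_apply, Pi.smul_apply, smul_eq_mul,
    mul_pow, hcpow] at key
  have h3 : (fun i => (1 / 2 * (c i * (1 + η i)) + 1 / 2 * (c i * (1 - η i))) ^ (j + 1)) = z := by
    funext i
    rw [← hcpow i]
    congr 1
    ring
  rw [h3] at key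
  exact EReal.exp_neg_mul_exp_neg_le_sq (hbot _) (hbot _) (hbot _) key

theorem ofReal_sq_eq_enorm_sq (a : ℝ) : ENNReal.ofReal (a ^ 2) = ‖a‖ₑ ^ 2 := by
  rw [Real.enorm_eq_ofReal_abs, ← ENNReal.ofReal_pow (abs_nonneg a), sq_abs]

theorem ofReal_abs_sq_eq_enorm_sq (a : ℝ) : ENNReal.ofReal (|a| ^ 2) = ‖a‖ₑ ^ 2 := by
  rw [sq_abs, ofReal_sq_eq_enorm_sq]

theorem enorm_partialDeriv_comp_signFlip {n : ℕ} (f : (Fin n → ℝ) → ℝ) (σ : Fin n → Bool)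
    (i : Fin n) (x : Fin n → ℝ) :
    ‖partialDeriv i (fun y => f (signFlip σ y)) x‖ₑ = ‖partialDeriv i f (signFlip σ x)‖ₑ := by
  rw [partialDeriv_comp_signFlip]
  split_ifs <;> simp

theorem ofReal_two_mul_weightedGradSq (j : ℕ) {n : ℕ} (f : (Fin n → ℝ) → ℝ)
    (σ : Fin n → Bool) (x : Fin n → ℝ) :
    ENNReal.ofReal (2 * weightedGradSq j (fun y => f (signFlip σ y)) x) =
      ∑ i, ENNReal.ofReal (((j : ℝ) + 1) ^ 2 / j * signFlip σ x i ^ 2) *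
        ‖partialDeriv i f (signFlip σ x)‖ₑ ^ 2 := by
  rw [weightedGradSq, Finset.mul_sum, ENNReal.ofReal_sum_of_nonneg fun i _ => by positivity]
  refine Finset.sum_congr rfl fun i _ => ?_
  rw [← enorm_partialDeriv_comp_signFlip, ← ofReal_sq_eq_enorm_sq, signFlip_sq,
    ← ENNReal.ofReal_mul (by positivity)]
  congr 1
  rcases eq_or_ne j 0 with rfl | hj
  · simp
  · field_simp

theorem update_bool_involutive {n : ℕ} (i : Fin n) :
    Function.Involutive fun σ : Fin n → Bool => Function.update σ i (!σ i) := by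
  intro σ
  simp

theorem signFlip_update_of_eq_zero {n : ℕ} (σ : Fin n → Bool) (i : Fin n) (b : Bool)
    {x : Fin n → ℝ} (hx : x i = 0) : signFlip (Function.update σ i b) x = signFlip σ x := by
  ext k
  rcases eq_or_ne k i with rfl | h
  · simp [signFlip_apply, hx]
  · simp [signFlip_apply, Function.update_of_ne h]

theorem ENNReal.add_sq_le_two_mul (a b : ℝ≥0∞) : (a + b) ^ 2 ≤ 2 * (a ^ 2 + b ^ 2) := by
  wlog h : a ≤ b generalizing a b
  · rw [add_comm a b, add_comm (a ^ 2)]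
    exact this b a (le_of_not_ge h)
  obtain ⟨c, rfl⟩ := exists_add_of_le h
  calc (a + (a + c)) ^ 2 = 4 * a ^ 2 + 4 * (a * c) + c ^ 2 := by ring
    _ ≤ 4 * a ^ 2 + 4 * (a * c) + c ^ 2 + c ^ 2 := le_self_add
    _ = _ := by ring

/-- The means of a function over two neighbouring orthants. -/
theorem enorm_integral_sub_sq_le {n : ℕ} {w : (Fin n → ℝ) → ℝ≥0∞} (hw : AEMeasurable w)
    (hanti : AntitoneOn w (posOrthant n)) {μ : Measure (Fin n → ℝ)} (hμ : μ = volume.withDensity w)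
    (hσ : ∀ σ, MeasurePreserving (signFlip σ) μ μ)
    {f : (Fin n → ℝ) → ℝ} (hf : LocallyLipschitz f) (hfi : Integrable f μ) (σ : Fin n → Bool)
    (i : Fin n) :
    ‖(∫ x in posOrthant n, f (signFlip σ x) ∂μ) -
      ∫ x in posOrthant n, f (signFlip (Function.update σ i (!σ i)) x) ∂μ‖ₑ ^ 2 ≤
      2 * (∫⁻ x in posOrthant n, ‖partialDeriv i f (signFlip σ x)‖ₑ ^ 2 ∂μ +
        ∫⁻ x in posOrthant n,
          ‖partialDeriv i f (signFlip (Function.update σ i (!σ i)) x)‖ₑ ^ 2 ∂μ) *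
        ∫⁻ x in posOrthant n, ENNReal.ofReal (x i ^ 2) ∂μ := by
  set τ := Function.update σ i (!σ i) with hτ
  set G : (Fin n → Bool) → (Fin n → ℝ) → ℝ≥0∞ := fun σ x => ‖partialDeriv i f (signFlip σ x)‖ₑ
    with hG
  have hGm : ∀ σ, Measurable (G σ) := fun σ =>
    ((measurable_partialDeriv hf.continuous i).comp
      (lipschitzWith_signFlip σ).continuous.measurable).enorm
  have hint : ∀ σ, IntegrableOn (fun x => f (signFlip σ x)) (posOrthant n) μ := fun σ =>
    ((hσ σ).integrable_comp_of_integrable hfi).integrableOn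
  have hlip : ∀ σ, LocallyLipschitz fun x => f (signFlip σ x) := fun σ =>
    hf.comp (lipschitzWith_signFlip σ).locallyLipschitz
  have hνeq : μ.restrict (posOrthant n) = (volume.restrict (posOrthant n)).withDensity w := by
    rw [hμ, restrict_withDensity (measurableSet_posOrthant n)]
  have hwO := hw.restrict (s := posOrthant n)
  have hconv : ∀ H : (Fin n → ℝ) → ℝ≥0∞, Measurable H →
      ∫⁻ x in posOrthant n, H x ∂μ = ∫⁻ x in posOrthant n, H x * w x := fun H hH => by
    rw [hνeq, lintegral_withDensity_eq_lintegral_mul₀ hwO hH.aemeasurable]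
    exact lintegral_congr fun x => mul_comm _ _
  have hg : Measurable fun x => G σ x + G τ x := (hGm σ).add (hGm τ)
  have h1 : ‖(∫ x in posOrthant n, f (signFlip σ x) ∂μ) -
      ∫ x in posOrthant n, f (signFlip τ x) ∂μ‖ₑ ≤
      ∫⁻ x in posOrthant n, (∫⁻ t in Set.Ioc 0 (x i),
        (G σ (Function.update x i t) + G τ (Function.update x i t))) ∂μ := by
    rw [← integral_sub (hint σ) (hint τ)]
    refine (enorm_integral_le_lintegral_enorm _).trans
      (setLIntegral_mono' (measurableSet_posOrthant n) fun x hx => ?_)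
    have h2 := (hlip σ).enorm_sub_update_le x (hx i)
    have h3 := (hlip τ).enorm_sub_update_le x (hx i)
    simp only [enorm_partialDeriv_comp_signFlip] at h2 h3
    rw [signFlip_update_of_eq_zero σ i _ (Function.update_self i 0 x)] at h3
    have hGs : Measurable fun t => G σ (Function.update x i t) :=
      (hGm σ).comp (lipschitzWith_update x i).continuous.measurable
    rw [lintegral_add_left hGs]
    refine le_trans ?_ (add_le_add h2 h3)
    -- The common value on the wall `x i = 0`, where the two reflections coincide.
    set p := f (signFlip σ (Function.update x i 0))
    calc ‖f (signFlip σ x) - f (signFlip τ x)‖ₑ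
        = ‖(f (signFlip σ x) - p) - (f (signFlip τ x) - p)‖ₑ := by congr 1; ring
      _ ≤ _ := enorm_sub_le
  have key := hardy_posOrthant i hwO hanti hg
  rw [← hconv _ (measurable_lintegral_update i hg), ← hconv _ (hg.pow_const 2),
    ← hconv _ ((measurable_pi_apply i).pow_const 2).ennreal_ofReal] at key
  refine (pow_le_pow_left' h1 2).trans (key.trans ?_)
  gcongr
  have hG2 : Measurable fun x => G σ x ^ 2 + G τ x ^ 2 :=
    ((hGm σ).pow_const 2).add ((hGm τ).pow_const 2)
  rw [← lintegral_add_left ((hGm σ).pow_const 2), ← lintegral_const_mul _ hG2]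
  exact lintegral_mono fun x => ENNReal.add_sq_le_two_mul (G σ x) (G τ x)

theorem theorem1p3 {n k : ℕ} (hk : 1 < k)
    (φ : (Fin n → ℝ) → EReal) (hφ_bot : ∀ x, φ x ≠ ⊥)
    (hφ_meas : AEMeasurable φ volume)
    (hφ_unc : Unconditional φ)
    (hφ_mono : MonotoneOn φ (posOrthant n))
    (hφ_conv : FracConvexOnOrthant (1 / (k : ℝ)) φ)
    (μ : Measure (Fin n → ℝ)) [IsProbabilityMeasure μ]
    (hμ : μ = volume.withDensity (fun x => EReal.exp (-φ x)))
    (f : (Fin n → ℝ) → ℝ) (hf_lip : LocallyLipschitz f)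
    (hf_int : Integrable f μ) (hf_mean : ∫ x, f x ∂μ = 0) :
    (∫⁻ x, ENNReal.ofReal (f x ^ 2) ∂μ ≤
      ∫⁻ x, ∑ i, (ENNReal.ofReal ((k : ℝ) ^ 2 / ((k : ℝ) - 1) * x i ^ 2) + secondMoment μ i) *
        ENNReal.ofReal (|partialDeriv i f x| ^ 2) ∂μ) ∧
    (Unconditional f →
      ∫⁻ x, ENNReal.ofReal (f x ^ 2) ∂μ ≤
        ∫⁻ x, ∑ i, ENNReal.ofReal ((k : ℝ) ^ 2 / ((k : ℝ) - 1) * x i ^ 2) *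
          ENNReal.ofReal (|partialDeriv i f x| ^ 2) ∂μ) := by
  obtain ⟨j, rfl⟩ : ∃ j, k = j + 1 := ⟨k - 1, by omega⟩
  have hj : 0 < j := by omega
  have hk1 : (((j + 1 : ℕ) : ℝ)) - 1 = j := by push_cast; ring
  have hk2 : (((j + 1 : ℕ) : ℝ)) = j + 1 := by push_cast; ring
  rw [hk1]
  simp only [ofReal_abs_sq_eq_enorm_sq]
  set w : (Fin n → ℝ) → ℝ≥0∞ := fun x => EReal.exp (-φ x) with hw_def
  have hw : AEMeasurable w := EReal.measurable_exp.comp_aemeasurable hφ_meas.neg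
  have hLC : PowMidLogConcave j w := powMidLogConcave_exp_neg hφ_bot hφ_conv
  have hanti : AntitoneOn w (posOrthant n) := fun x hx y hy hxy =>
    EReal.exp_monotone (EReal.neg_le_neg_iff.2 (hφ_mono hx hy hxy))
  have hw_unc : Unconditional w := fun x => by simp only [hw_def]; rw [hφ_unc x]
  have hac : μ ≪ volume := hμ ▸ withDensity_absolutelyContinuous _ _
  have hσ : ∀ σ, MeasurePreserving (signFlip σ) μ μ := fun σ => by
    rw [hμ]; exact measurePreserving_signFlip_withDensity σ hw_unc
  set c := μ (posOrthant n) with hc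
  -- All `2 ^ n` orthants have the same mass.
  have h2c : 2 ^ n * c = 1 := by
    have h := lintegral_eq_sum_signFlip hac hσ fun _ => 1
    simp only [lintegral_const, measure_univ, mul_one, Measure.restrict_apply_univ, one_mul,
      Finset.sum_const, Finset.card_univ, Fintype.card_fun, Fintype.card_bool, Fintype.card_fin,
      nsmul_eq_mul] at h
    rw [h]
    push_cast
    rfl
  set Q : (Fin n → ℝ) → ℝ≥0∞ := fun x => ∑ i,
    ENNReal.ofReal (((j + 1 : ℕ) : ℝ) ^ 2 / j * x i ^ 2) * ‖partialDeriv i f x‖ₑ ^ 2 with hQ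
  set a : (Fin n → Bool) → ℝ := fun σ => ∫ x in posOrthant n, f (signFlip σ x) ∂μ with ha
  have ha_sum : ∑ σ, a σ = 0 := by rw [← integral_eq_sum_signFlip hac hσ hf_int, hf_mean]
  -- The variance splits into a part inside the orthants, controlled by `Q`, and a part between
  -- them, carried by the integrals `a σ`.
  have hmain : ∫⁻ x, ENNReal.ofReal (f x ^ 2) ∂μ ≤
      2 ^ n * ∑ σ, ENNReal.ofReal (a σ ^ 2) + ∫⁻ x, Q x ∂μ := by
    have hstep : ∀ σ, c * ∫⁻ x in posOrthant n, ENNReal.ofReal (f (signFlip σ x) ^ 2) ∂μ ≤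
        ENNReal.ofReal (a σ ^ 2) + c * ∫⁻ x in posOrthant n, Q (signFlip σ x) ∂μ := by
      intro σ
      have h := variance_le_posOrthant hj hw.restrict hLC
        (ν := μ.restrict (posOrthant n))
        (by rw [hμ, restrict_withDensity (measurableSet_posOrthant n)])
        (hf_lip.comp (lipschitzWith_signFlip σ).locallyLipschitz)
        ((hσ σ).integrable_comp_of_integrable hf_int).restrict
      rw [Measure.restrict_apply_univ] at h
      simp only [Function.comp_def, ofReal_two_mul_weightedGradSq] at h
      simpa only [hQ, hk2] using h
    have hsum := Finset.sum_le_sum fun σ (_ : σ ∈ Finset.univ) => hstep σ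
    rw [← Finset.mul_sum, Finset.sum_add_distrib, ← Finset.mul_sum,
      ← lintegral_eq_sum_signFlip hac hσ fun x => ENNReal.ofReal (f x ^ 2),
      ← lintegral_eq_sum_signFlip hac hσ Q] at hsum
    calc ∫⁻ x, ENNReal.ofReal (f x ^ 2) ∂μ
        = 2 ^ n * (c * ∫⁻ x, ENNReal.ofReal (f x ^ 2) ∂μ) := by rw [← mul_assoc, h2c, one_mul]
      _ ≤ 2 ^ n * (∑ σ, ENNReal.ofReal (a σ ^ 2) + c * ∫⁻ x, Q x ∂μ) := by gcongr
      _ = _ := by rw [mul_add, ← mul_assoc (2 ^ n) c, h2c, one_mul]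
  refine ⟨?_, fun hf_unc => ?_⟩
  · have hpm : ∀ i, Measurable fun x => ‖partialDeriv i f x‖ₑ ^ 2 := fun i =>
      (measurable_partialDeriv hf_lip.continuous i).enorm.pow_const 2
    have hQm : Measurable Q := Finset.measurable_fun_sum _ fun i _ =>
      (((measurable_pi_apply i).pow_const 2).const_mul _).ennreal_ofReal.mul (hpm i)
    set v : Fin n → ℝ≥0∞ := fun i => ∫⁻ x in posOrthant n, ENNReal.ofReal (x i ^ 2) ∂μ with hv
    have hV : ∀ i, secondMoment μ i = 2 ^ n * v i := fun i => by
      rw [secondMoment, lintegral_eq_sum_signFlip hac hσ]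
      simp only [signFlip_sq, Finset.sum_const, Finset.card_univ, Fintype.card_fun,
        Fintype.card_bool, Fintype.card_fin, nsmul_eq_mul]
      push_cast
      rfl
    have hrhs : ∫⁻ x, ∑ i, (ENNReal.ofReal (((j + 1 : ℕ) : ℝ) ^ 2 / j * x i ^ 2) +
        secondMoment μ i) * ‖partialDeriv i f x‖ₑ ^ 2 ∂μ =
        ∑ i, secondMoment μ i * ∫⁻ x, ‖partialDeriv i f x‖ₑ ^ 2 ∂μ + ∫⁻ x, Q x ∂μ := by
      simp only [add_mul, Finset.sum_add_distrib]
      rw [lintegral_add_left hQm, add_comm,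
        lintegral_finsetSum _ fun i _ => (hpm i).const_mul _]
      congr 1
      exact Finset.sum_congr rfl fun i _ => lintegral_const_mul _ (hpm i)
    rw [hrhs]
    refine hmain.trans (add_le_add ?_ le_rfl)
    have hcube := sum_sq_le_cube n a
    rw [ha_sum] at hcube
    have hcube' : 4 * (2 ^ n * ∑ σ, ENNReal.ofReal (a σ ^ 2)) ≤
        2 ^ n * ∑ i, ∑ σ, ‖a σ - a (Function.update σ i (!σ i))‖ₑ ^ 2 := by
      simp only [← ofReal_sq_eq_enorm_sq]
      rw [Finset.sum_comm]
      simp only [← ENNReal.ofReal_sum_of_nonneg fun _ _ => sq_nonneg _]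
      rw [← ENNReal.ofReal_sum_of_nonneg fun _ _ => Finset.sum_nonneg fun _ _ => sq_nonneg _,
        show (2 : ℝ≥0∞) ^ n = ENNReal.ofReal (2 ^ n) by
          rw [ENNReal.ofReal_pow zero_le_two, ENNReal.ofReal_ofNat],
        ← ENNReal.ofReal_ofNat 4, ← ENNReal.ofReal_mul (by positivity),
        ← ENNReal.ofReal_mul (by positivity), ← ENNReal.ofReal_mul (by positivity)]
      refine ENNReal.ofReal_le_ofReal ?_
      linarith
    -- One factor `2` comes from the square of a sum, the other from `σ` and its neighbour each
    -- running over all orthants. Their product cancels the `1 / 4` of the cube inequality, and `2 ^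
    -- n * v i = V_i`.
    have hdiff : ∀ i, ∑ σ, ‖a σ - a (Function.update σ i (!σ i))‖ₑ ^ 2 ≤
        4 * ((∫⁻ x, ‖partialDeriv i f x‖ₑ ^ 2 ∂μ) * v i) := by
      intro i
      have h := Finset.sum_le_sum fun σ (_ : σ ∈ Finset.univ) =>
        enorm_integral_sub_sq_le hw hanti hμ hσ hf_lip hf_int σ i
      refine h.trans (le_of_eq ?_)
      rw [← Finset.sum_mul, ← Finset.mul_sum, Finset.sum_add_distrib,
        (update_bool_involutive i).bijective.sum_comp fun σ =>
          ∫⁻ x in posOrthant n, ‖partialDeriv i f (signFlip σ x)‖ₑ ^ 2 ∂μ,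
        ← lintegral_eq_sum_signFlip hac hσ fun x => ‖partialDeriv i f x‖ₑ ^ 2]
      ring
    have h4 : 4 * (2 ^ n * ∑ σ, ENNReal.ofReal (a σ ^ 2)) ≤
        4 * ∑ i, secondMoment μ i * ∫⁻ x, ‖partialDeriv i f x‖ₑ ^ 2 ∂μ := by
      refine hcube'.trans ((mul_le_mul' le_rfl (Finset.sum_le_sum fun i _ => hdiff i)).trans
        (le_of_eq ?_))
      rw [Finset.mul_sum, Finset.mul_sum]
      refine Finset.sum_congr rfl fun i _ => ?_
      rw [hV]
      ring
    exact (ENNReal.mul_le_mul_iff_right (by norm_num) (by norm_num)).1 h4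
  · have hf_flip : ∀ σ x, f (signFlip σ x) = f x := fun σ x => by
      rw [hf_unc x, hf_unc (signFlip σ x)]
      simp only [abs_signFlip]
    -- For unconditional `f` the `a σ` are all equal and sum to zero, so the part between the
    -- orthants vanishes.
    have ha_zero : ∀ σ, a σ = 0 := by
      have h : ∀ σ, a σ = ∫ x in posOrthant n, f x ∂μ := fun σ => by simp only [ha, hf_flip]
      intro σ
      simp only [h, Finset.sum_const, Finset.card_univ, nsmul_eq_mul] at ha_sum
      rw [h σ]
      exact (mul_eq_zero.1 ha_sum).resolve_left (Nat.cast_ne_zero.2 Fintype.card_ne_zero)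
    simpa [ha_zero] using hmain
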